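/- **Setting.** Let $\mu$ be a probability law on $\mathbb{N}=\{0,1,2,\dots\}$ with $\sum_k k\mu(k)=1$ and $\mathcal{P}$ a probability law on $\mathbb{R}^d$. Under $\mathbf{P}$, a branching random walk starts from one particle at $0$ (generation $0$); every particle independently has a number of children with law $\mu$, and each child is displaced from its parent independently with law $\mathcal{P}$. Write $S_u$ for the position of a particle $u$, $|u|$ for its generation, and $Z_n(A)=\#\{u:|u|=n,\ S_u\in A\}$; write $A-x=\{y: y+x\in A\}$. Consider two cases. * $(\mathcal{H}_1)$ $d\ge 3$, $\mathcal{P}$ is the standard Gaussian law on $\mathbb{R}^d$, $\Sigma=I_d$, and $\sum_k k^2\mu(k)<\infty$. * $(\mathcal{H}_2)$ $d\ge 3$, $\mathcal{P}=\sum_{x\in\mathcal{R}}p(x)\delta_x$ with $\mathcal{R}\subset\mathbb{Z}^d$ finite, $-x\in\mathcal{R}$ and $p(-x)=p(x)$ for all $x\in\mathcal{R}$; the covariance matrix $\Sigma$ of $\mathcal{P}$ is positive definite; the random walk $\hat S$ with motion law $\mathcal{P}$ started from $0$ is irreducible on $\mathbb{Z}^d$ and aperiodic (for every $x\in\mathbb{Z}^d$,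 $\mathbb{P}(\hat S_n=x)>0$ for all large $n$); and $\sum_k k^2\mu(k)<\infty$. **The constant $I_A$.** Let $\mathbf{Q}^*$ be the law of the size-biased branching random walk with spine $(w_k)_{k\ge 0}$: $w_0$ is one particle at $0$; $w_k$ has $k'$ children with probability $\nu(k')=k'\mu(k')$, and $w_{k+1}$ is chosen uniformly among the children of $w_k$; all other particles have a number of children with law $\mu$; all displacements from parent to child have law $\mathcal{P}$; all these choices are independent. Let $B(w_{k+1})$ be the set of children of $w_k$ other than $w_{k+1}$, let $\rho_u$ be the displacement of $u$ from its parent, and let $Z^u_k(\cdot)$ count the descendants of $u$, $k$ generations after $u$, by their positions relative to $S_u$. For a closed ball $A$ and $k\ge1$ put $$\tilde Y_k(z)=\sum_{u\in B(w_{k+1})}Z^u_{k-1}(A-z-\rho_u),\qquad G_A(y)=\mathbb{E}_{\mathbf{Q}^*}\!\left[\frac{1}{1+\sum_{k\ge1}\tilde Y_k(y-S_{w_k})}\right],$$ and $I_A=\int_A G_A(y)\,dy$ under $\mathcal{H}_1$, $I_A=\sum_{y\in A\cap\mathbb{Z}^d}G_A(y)$ under $\mathcal{H}_2$. **Proposition.**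 Let $A$ be a closed Euclidean ball of positive radius in $\mathbb{R}^d$ and let $a\in\mathbb{R}^d$. Assume either * $\mathcal{H}_1$, and $a_n=a\sqrt n$ for every $n$; or * $\mathcal{H}_2$, $A\cap\mathbb{Z}^d\neq\emptyset$, and $(a_n)$ is any sequence in $\mathbb{Z}^d$ with $a_n/\sqrt n\to a$. Then, as $n\to\infty$, $$\mathbf{P}\big(Z_n(A-a_n)\ge1\big)\sim I_A\,(2\pi)^{-d/2}\det(\Sigma)^{-1/2}e^{-\langle a,\Sigma^{-1}a\rangle/2}\,n^{-d/2}.$$ -/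

import Mathlib

open MeasureTheory ProbabilityTheory Filter Topology Asymptotics
open scoped ENNReal

noncomputable section

namespace CBRW

/-- The state space `ℝ^d` with its Euclidean norm. -/
abbrev E (d : ℕ) : Type := EuclideanSpace ℝ (Fin d)

/-- The integer lattice `ℤ^d` inside `ℝ^d`. -/
def intLattice (d : ℕ) : Set (E d) := {x | ∀ i, ∃ z : ℤ, x i = z}

/-- The translated set `A - x = {y | y + x ∈ A}`. -/
def translate {d : ℕ} (A : Set (E d)) (x : E d) : Set (E d) := {y | y + x ∈ A}

/-! ### Offspring laws -/

/-- The offspring law has mean one. -/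
def IsCritical (μ : PMF ℕ) : Prop := ∑' k : ℕ, (k : ℝ≥0∞) * μ k = 1

/-- The offspring law has a finite second moment. -/
def HasSecondMoment (μ : PMF ℕ) : Prop := ∑' k : ℕ, (k : ℝ≥0∞) ^ 2 * μ k < ∞

/-- The size-biased offspring law `ν(k) = k μ(k)`. -/
def sizeBiased (μ : PMF ℕ) (hμ : IsCritical μ) : PMF ℕ :=
  ⟨fun k => (k : ℝ≥0∞) * μ k, by
    have h : ∑' k : ℕ, (k : ℝ≥0∞) * μ k = 1 := hμ
    rw [← h]
    exact ENNReal.summable.hasSum⟩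

/-! ### Spatial trees -/

/-- Labels of particles. The root is `[]` and the children of `u` are `i :: u`, `i = 0, 1, 2, …`;
the generation of `u` is its length, and the descendants of `u` are the labels `v ++ u`. -/
abbrev Node : Type := List ℕ

/-- A marked tree: every label `u` carries the number of children of `u` and the displacement
of `u` from its parent. The displacement carried by the root is never used. -/
abbrev MarkedTree (d : ℕ) : Type := Node → ℕ × E d

/-- The label `u` is a particle of the tree. -/
def Alive {d : ℕ} (T : MarkedTree d) : Node → Prop
  | [] => True
  | i :: u => Alive T u ∧ i < (T u).1

/-- The position `S_u`, when the root is located at the origin. -/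
def position {d : ℕ} (T : MarkedTree d) : Node → E d
  | [] => 0
  | i :: u => position T u + (T (i :: u)).2

/-- The number `Z_n(A)` of particles of generation `n` located in `A`. -/
def count {d : ℕ} (T : MarkedTree d) (n : ℕ) (A : Set (E d)) : ℕ∞ :=
  {u : Node | u.length = n ∧ Alive T u ∧ position T u ∈ A}.encard

/-- The subtree `T^u` of the descendants of `u`, with positions taken relative to that of `u`. -/
def subtree {d : ℕ} (T : MarkedTree d) (u : Node) : MarkedTree d := fun v => T (v ++ u)

/-! ### The critical branching random walk started from one particle at the origin -/

/-- The law of the branching random walk with offspring law `μ` and motion law `P`: numbers of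
children have law `μ`, displacements have law `P`, and all of them are independent. -/
def bpLaw {d : ℕ} (μ : PMF ℕ) (P : Measure (E d)) : Measure (MarkedTree d) :=
  Measure.infinitePi fun _ : Node => μ.toMeasure.prod P

/-! ### The size-biased branching random walk and its spine -/

/-- The uniform law on `{0, …, k - 1}` (a Dirac mass at `0` for `k = 0`, which is never used
because a size-biased number of children is almost surely positive). -/
def uniformChild : ℕ → PMF ℕ
  | 0 => PMF.pure 0
  | k + 1 => PMF.uniformOfFinset (Finset.range (k + 1)) Finset.nonempty_range_add_one

/-- The joint law of the number of children of a spine particle, which has law `ν`, and of the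
index of the next spine particle, which is uniform among these children. -/
def spineStepLaw (μ : PMF ℕ) (hμ : IsCritical μ) : PMF (ℕ × ℕ) :=
  (sizeBiased μ hμ).bind fun k => (uniformChild k).map fun j => (k, j)

/-- The sample space of the size-biased process: a marked tree (from which the displacements of all
particles and the numbers of children of the particles off the spine are read), and for every `k`
the number of children of the `k`-th spine particle with the index of the next spine particle. -/
abbrev SpineSpace (d : ℕ) : Type := MarkedTree d × (ℕ → ℕ × ℕ)

/-- The probability measure on `SpineSpace` under which all these variables are independent. -/
def spineLaw {d : ℕ} (μ : PMF ℕ) (hμ : IsCritical μ) (P : Measure (E d)) :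
    Measure (SpineSpace d) :=
  (bpLaw μ P).prod (Measure.infinitePi fun _ : ℕ => (spineStepLaw μ hμ).toMeasure)

/-- The spine `w_0, w_1, w_2, …`. -/
def spine {d : ℕ} (ω : SpineSpace d) : ℕ → Node
  | 0 => []
  | k + 1 => (ω.2 k).2 :: spine ω k

/-- The size-biased tree. -/
def spineTree {d : ℕ} (ω : SpineSpace d) : MarkedTree d := fun u =>
  (if u = spine ω u.length then (ω.2 u.length).1 else (ω.1 u).1, (ω.1 u).2)

/-- The brothers `B(w_{k+1})`: the children of `w_k` other than `w_{k+1}`. -/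
def brothers {d : ℕ} (ω : SpineSpace d) (k : ℕ) : Finset Node :=
  ((Finset.range (spineTree ω (spine ω k)).1).image fun i => i :: spine ω k).erase
    (spine ω (k + 1))

/-- For `k ≥ 1`, the variable `Ỹ_k(z)`: the sum over `u ∈ B(w_{k+1})` of `Z^u_{k-1}(A - z - ρ_u)`,
where `ρ_u` is the displacement of `u` from its parent. -/
def tildeY {d : ℕ} (A : Set (E d)) (ω : SpineSpace d) (k : ℕ) (z : E d) : ℕ∞ :=
  ∑ u ∈ brothers ω k,
    count (subtree (spineTree ω) u) (k - 1) (translate A (z + (spineTree ω u).2))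

/-- `G_A(y)`, the expectation of `1 / (1 + ∑_{k ≥ 1} Ỹ_k(y - S_{w_k}))` for the size-biased
process. -/
def G {d : ℕ} (μ : PMF ℕ) (hμ : IsCritical μ) (P : Measure (E d)) (A : Set (E d)) (y : E d) :
    ℝ≥0∞ :=
  ∫⁻ ω, (1 + ∑' k : ℕ,
    ((tildeY A ω (k + 1) (y - position (spineTree ω) (spine ω (k + 1))) : ℕ∞) : ℝ≥0∞))⁻¹
    ∂(spineLaw μ hμ P)

/-- `I_A` in the Gaussian case: the integral of `G_A` over `A`. -/
def IGauss {d : ℕ} (μ : PMF ℕ) (hμ : IsCritical μ) (P : Measure (E d)) (A : Set (E d)) : ℝ :=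
  (∫⁻ y in A, G μ hμ P A y).toReal

/-- `I_A` in the lattice case: the sum of `G_A` over `A ∩ ℤ^d`. -/
def ILattice {d : ℕ} (μ : PMF ℕ) (hμ : IsCritical μ) (P : Measure (E d)) (A : Set (E d)) : ℝ :=
  (∑' y : (A ∩ intLattice d : Set (E d)), G μ hμ P A y).toReal

/-! ### The two sets of hypotheses -/

/-- The law at time `n` of the random walk with motion law `P` started from `0`. -/
def walkLaw {d : ℕ} (P : Measure (E d)) : ℕ → Measure (E d)
  | 0 => Measure.dirac 0
  | n + 1 => Measure.conv (walkLaw P n) P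

/-- The random walk is irreducible on `ℤ^d` and aperiodic: every lattice point is charged at all
large times. -/
def IsAperiodic {d : ℕ} (P : Measure (E d)) : Prop :=
  ∀ x ∈ intLattice d, ∀ᶠ n : ℕ in atTop, 0 < walkLaw P n {x}

/-- The covariance matrix of `P`. -/
def covMatrix {d : ℕ} (P : Measure (E d)) : Matrix (Fin d) (Fin d) ℝ :=
  Matrix.of fun i j => covariance (fun x : E d => x i) (fun x : E d => x j) P

/-- The Gaussian case, with `S = I_d`. -/
structure HypH1 {d : ℕ} (μ : PMF ℕ) (P : Measure (E d)) (S : Matrix (Fin d) (Fin d) ℝ) :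
    Prop where
  dim : 3 ≤ d
  motion : P = stdGaussian (E d)
  cov : S = 1
  second_moment : HasSecondMoment μ

/-- The lattice case: a symmetric motion law with finite range in `ℤ^d` and positive definite
covariance matrix `S`, which generates an aperiodic random walk. -/
structure HypH2 {d : ℕ} (μ : PMF ℕ) (P : Measure (E d)) (S : Matrix (Fin d) (Fin d) ℝ) :
    Prop where
  dim : 3 ≤ d
  motion : ∃ (R : Finset (E d)) (p : E d → ℝ≥0∞), (R : Set (E d)) ⊆ intLattice d ∧
    P = ∑ x ∈ R, p x • Measure.dirac x ∧ ∀ x ∈ R, -x ∈ R ∧ p (-x) = p x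
  cov : S = covMatrix P
  cov_posDef : S.PosDef
  aperiodic : IsAperiodic P
  second_moment : HasSecondMoment μ

/-- `(2π)^{-d/2} det(S)^{-1/2} exp(-⟨a, S⁻¹ a⟩ / 2)`. -/
def gaussDensity {d : ℕ} (S : Matrix (Fin d) (Fin d) ℝ) (a : E d) : ℝ :=
  (2 * Real.pi) ^ (-(d : ℝ) / 2) * S.det ^ (-(1 : ℝ) / 2) *
    Real.exp (-inner ℝ a (Matrix.toEuclideanLin S⁻¹ a) / 2)

end CBRW

end

/-! Let h_n(x) (`hit`) be the probability that generation n charges A when the root sits at x, let Q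
(`transfer`) be the transition operator of the random walk, and let λ be Lebesgue measure or
counting measure on the lattice. The proof compares h_n with the walk and identifies I_A by an exact
identity; three facts carry it.

(1) Almost linear evolution. Branching at the root gives h_{n+1} = E[1 - (1 - Q h_n)^N]
(`hit_succ`). Since E[N] = 1, this is at most Q h_n and at least Q h_n - E[N²] (Q h_n)². As h_n ≤
Q^n 1_A, the relative loss at step n is O((n+1)^{-d/2}), which is summable for d ≥ 3. Hence (1 -
D_K) Q^m h_K ≤ h_{K+m} ≤ Q^m h_K, where D_K is the tail of a convergent series (`hit_add_le`,
`iterate_transfer_le_hit`, `LocalLimit.exists_summable`).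

(2) Local limit theorem. For fixed K and n = K + m, n^{d/2} Q^m h_K(a_n) tends to the Gaussian
density times J_K = ∫ h_K dλ (`LocalLimit.tendsto_iterate`). In the Gaussian case the density of the
walk is explicit; on the lattice Fourier inversion is used.

(3) J_K tends to I_A. For Z the number of particles of generation K in A, 1_{Z ≥ 1} = ∫_0^1 Z
τ^{Z-1} dτ. The expectation of Z τ^{Z-1} satisfies a product recursion along the walk
(`genDeriv_succ`), and E[τ^Y], for Y the number of relatives of the spine counted in the denominator
of G_A up to level K, satisfies the dual recursion (`lintegral_pow_totalBro`), because size biasing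
replaces the offspring generating function by its derivative. Invariance of λ exchanges the two, and
integration over τ turns τ^Y into 1/(1+Y). So J_K is exactly the integral over A of the truncated
G_A (`setLIntegral_truncG`), which decreases to I_A.

Letting m, then K, tend to infinity gives the limit of n^{d/2} h_n(a_n). The lower bound of (1),
integrated against λ, shows I_A > 0, so that the limit is a genuine equivalence. -/

noncomputable section

namespace CBRW

/-! ### Decomposition of the tree at its root -/

/-- A product measure is the image of the product of one of its factors with the others. -/
lemma map_prod_infinitePi {ι κ X : Type*} [MeasurableSpace X] (m : Measure X)
    [IsProbabilityMeasure m] {o : ι} {f : κ → ι} (hf : Function.Injective f)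
    (hr : ∀ u, u ∈ Set.range f ↔ u ≠ o) {g : X × (κ → X) → ι → X} (hg : Measurable g)
    (h0 : ∀ p, g p o = p.1) (h1 : ∀ p k, g p (f k) = p.2 k) :
    (m.prod (Measure.infinitePi fun _ : κ => m)).map g = Measure.infinitePi fun _ : ι => m := by
  refine Measure.eq_infinitePi _ fun s t ht => ?_
  classical
  rw [Measure.map_apply hg (MeasurableSet.pi (Finset.countable_toSet s) fun i _ => ht i)]
  have hset : g ⁻¹' (Set.pi s t) = (if o ∈ s then t o else Set.univ) ×ˢ
      Set.pi (s.preimage _ hf.injOn) (fun k => t (f k)) := by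
    ext p
    simp only [Set.mem_preimage, Set.mem_pi, Set.mem_prod, Finset.mem_coe, Finset.mem_preimage]
    constructor
    · intro h
      refine ⟨?_, fun q hq => by simpa [h1] using h _ hq⟩
      split_ifs with ho
      · simpa [h0] using h _ ho
      · trivial
    · rintro ⟨ho, hk⟩ u hu
      by_cases huo : u = o
      · subst huo
        simpa [hu, h0] using ho
      · obtain ⟨k, rfl⟩ := (hr u).2 huo
        simpa [h1] using hk k hu
  rw [hset, Measure.prod_prod, Measure.infinitePi_pi _ fun i _ => ht _,
    Finset.prod_preimage' _ s _ fun u => m (t u)]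
  simp_rw [hr]
  rw [Finset.filter_ne']
  split_ifs with ho
  · rw [Finset.mul_prod_erase s (fun u => m (t u)) ho]
  · rw [measure_univ, one_mul, Finset.erase_eq_of_notMem ho]

section Split

variable {d : ℕ}

/-- The mark of the root and the subtrees of its potential children. -/
def split (T : MarkedTree d) : (ℕ × E d) × (ℕ → MarkedTree d) :=
  (T [], fun i => subtree T [i])

/-- Assembles a tree from the mark of its root and all other marks. -/
def graft (p : (ℕ × E d) × (ℕ × Node → ℕ × E d)) : MarkedTree d := fun u =>
  if h : u = [] then p.1 else p.2 (u.getLast h, u.dropLast)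

@[simp] lemma graft_nil (p : (ℕ × E d) × (ℕ × Node → ℕ × E d)) : graft p [] = p.1 := by
  simp [graft]

@[simp] lemma graft_append (p : (ℕ × E d) × (ℕ × Node → ℕ × E d)) (v : Node) (i : ℕ) :
    graft p (v ++ [i]) = p.2 (i, v) := by
  simp [graft]

lemma measurable_graft : Measurable (graft (d := d)) := by
  refine measurable_pi_lambda _ fun u => ?_
  by_cases h : u = []
  · simpa [graft, h] using measurable_fst
  · simp only [graft, h, dite_false]
    fun_prop

lemma measurable_subtree (u : Node) : Measurable fun T : MarkedTree d => subtree T u := by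
  unfold subtree
  fun_prop

lemma measurable_split : Measurable (split (d := d)) :=
  (measurable_pi_apply _).prodMk (measurable_pi_lambda _ fun _ => measurable_subtree _)

variable (μ : PMF ℕ) (P : Measure (E d)) [IsProbabilityMeasure P]

instance : IsProbabilityMeasure (bpLaw μ P) := by
  unfold bpLaw
  infer_instance

lemma injective_append_singleton : Function.Injective fun q : ℕ × Node => q.2 ++ [q.1] := by
  rintro ⟨i, v⟩ ⟨j, w⟩ h
  have := List.append_inj' h rfl
  simp_all

lemma map_graft : ((μ.toMeasure.prod P).prod
    (Measure.infinitePi fun _ : ℕ × Node => μ.toMeasure.prod P)).map graft = bpLaw μ P := by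
  refine map_prod_infinitePi _ (o := []) injective_append_singleton (fun u => ?_) measurable_graft
    graft_nil fun p q => graft_append p q.2 q.1
  constructor
  · rintro ⟨q, rfl⟩
    simp
  · intro h
    exact ⟨(u.getLast h, u.dropLast), List.dropLast_append_getLast h⟩

/-- The branching property. The first-generation ancestor of a label is its last entry, so nonempty
labels correspond to pairs (child of the root, label in its subtree); currying an i.i.d. family over
such pairs gives i.i.d. trees. -/
lemma map_split : (bpLaw μ P).map split =
    (μ.toMeasure.prod P).prod (Measure.infinitePi fun _ : ℕ => bpLaw μ P) := by
  rw [← map_graft, Measure.map_map measurable_split measurable_graft]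
  have : split ∘ graft (d := d) = Prod.map id (MeasurableEquiv.curry ℕ Node (ℕ × E d)) := by
    ext1 p
    refine Prod.ext (by simp [split]) ?_
    funext i v
    simp [split, subtree]
  rw [this, ← Measure.map_prod_map _ _ measurable_id (MeasurableEquiv.measurable _),
    Measure.map_id, Measure.infinitePi_map_curry (fun (_ : ℕ) (_ : Node) => μ.toMeasure.prod P)]
  rw [map_graft]
  rfl

lemma lintegral_split {F : (ℕ × E d) × (ℕ → MarkedTree d) → ℝ≥0∞} (hF : Measurable F) :
    ∫⁻ T, F (split T) ∂(bpLaw μ P) =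
      ∫⁻ r, ∫⁻ f, F (r, f) ∂(Measure.infinitePi fun _ : ℕ => bpLaw μ P) ∂(μ.toMeasure.prod P) := by
  rw [← lintegral_map hF measurable_split, map_split, lintegral_prod _ hF.aemeasurable]

lemma lintegral_prod_infinitePi {ι α : Type*} [MeasurableSpace α] (m : Measure α)
    [IsProbabilityMeasure m] (s : Finset ι) {X : ι → α → ℝ≥0∞} (hX : ∀ i, Measurable (X i)) :
    ∫⁻ f, ∏ i ∈ s, X i (f i) ∂(Measure.infinitePi fun _ : ι => m) = ∏ i ∈ s, ∫⁻ a, X i a ∂m := by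
  refine (lintegral_prod_eq_prod_lintegral_of_indepFun s (fun i (f : ι → α) => X i (f i))
    (iIndepFun_infinitePi hX) (fun i => (hX i).comp (measurable_pi_apply i))).trans ?_
  refine Finset.prod_congr rfl fun i _ => ?_
  exact (lintegral_map (hX i) (measurable_pi_apply i)).symm.trans
    (by rw [Measure.infinitePi_map_eval (fun _ : ι => m) i])

lemma map_subtree (u : Node) : (bpLaw μ P).map (fun T => subtree T u) = bpLaw μ P :=
  Measure.map_infinitePi_infinitePi_of_inj (P := fun _ : Node => μ.toMeasure.prod P)
    (f := fun v : Node => v ++ u) fun _ _ h => List.append_cancel_right h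

lemma lintegral_subtree (u : Node) {F : MarkedTree d → ℝ≥0∞} (hF : Measurable F) :
    ∫⁻ T, F (subtree T u) ∂(bpLaw μ P) = ∫⁻ T, F T ∂(bpLaw μ P) := by
  rw [← lintegral_map hF (measurable_subtree u), map_subtree]

end Split

/-! ### Counting particles from the root -/

section Count

variable {d : ℕ}

lemma subtree_subtree (T : MarkedTree d) (u v : Node) :
    subtree (subtree T u) v = subtree T (v ++ u) := by
  funext w
  simp [subtree]

lemma alive_append_singleton (T : MarkedTree d) (i : ℕ) (v : Node) :
    Alive T (v ++ [i]) ↔ i < (T []).1 ∧ Alive (subtree T [i]) v := by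
  induction v with
  | nil => simp [Alive]
  | cons j v ih =>
    simp only [List.cons_append, Alive, ih, subtree]
    tauto

lemma position_append_singleton (T : MarkedTree d) (i : ℕ) (v : Node) :
    position T (v ++ [i]) = (T [i]).2 + position (subtree T [i]) v := by
  induction v with
  | nil => simp [position]
  | cons j v ih =>
    simp only [List.cons_append, position, ih, subtree, add_assoc]

variable (A : Set (E d))

open Classical in
/-- The number of particles of generation `n` located in `A`, when the root is located at `x`. -/
def cnt : ℕ → MarkedTree d → E d → ℕ
  | 0, _, x => if x ∈ A then 1 else 0
  | n + 1, T, x => ∑ i ∈ Finset.range (T []).1, cnt n (subtree T [i]) (x + (T [i]).2)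

/-- The same as `cnt`, when the parent of the root is located at `x`. -/
def childCnt (n : ℕ) (T : MarkedTree d) (x : E d) : ℕ := cnt A n T (x + (T []).2)

lemma cnt_succ (n : ℕ) (T : MarkedTree d) (x : E d) :
    cnt A (n + 1) T x = ∑ i ∈ Finset.range (split T).1.1, childCnt A n ((split T).2 i) x := by
  simp [cnt, childCnt, split, subtree]

/-- Links the cardinality in the definition of the model with the recursion used in all
computations. Particles of generation n + 1 are partitioned by their first-generation ancestor, the
last entry i of the label v ++ [i]. -/
lemma count_translate (n : ℕ) (T : MarkedTree d) (x : E d) :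
    count T n (translate A x) = cnt A n T x := by
  induction n generalizing T x with
  | zero =>
    unfold count cnt translate
    split_ifs with h
    · have : {u : Node | u.length = 0 ∧ Alive T u ∧ position T u ∈ {y | y + x ∈ A}} = {[]} := by
        ext u
        simp only [List.length_eq_zero_iff, Set.mem_ofPred_eq, Set.mem_singleton_iff]
        constructor
        · exact fun h => h.1
        · rintro rfl
          simpa [Alive, position] using h
      rw [this]
      simp
    · have : {u : Node | u.length = 0 ∧ Alive T u ∧ position T u ∈ {y | y + x ∈ A}} = ∅ := by
        ext u
        simp only [List.length_eq_zero_iff, Set.mem_ofPred_eq, Set.mem_empty_iff_false, iff_false]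
        rintro ⟨rfl, -, h'⟩
        simp [position] at h'
        exact h h'
      rw [this]
      simp
  | succ n ih =>
    have hu : {u : Node | u.length = n + 1 ∧ Alive T u ∧ position T u ∈ translate A x} =
        ⋃ i ∈ Finset.range (T []).1, (fun v : Node => v ++ [i]) ''
          {v : Node | v.length = n ∧ Alive (subtree T [i]) v ∧
            position (subtree T [i]) v ∈ translate A (x + (T [i]).2)} := by
      ext u
      simp only [Set.mem_ofPred_eq, Set.mem_iUnion, Finset.mem_range, Set.mem_image, exists_prop,
        translate]
      constructor
      · rintro ⟨h1, h2, h3⟩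
        rcases List.eq_nil_or_concat' u with rfl | ⟨v, i, rfl⟩
        · simp at h1
        · rw [alive_append_singleton] at h2
          rw [position_append_singleton] at h3
          refine ⟨i, h2.1, v, ⟨by simpa using h1, h2.2, ?_⟩, rfl⟩
          convert h3 using 1
          abel
      · rintro ⟨i, hi, v, ⟨h1, h2, h3⟩, rfl⟩
        rw [alive_append_singleton, position_append_singleton]
        refine ⟨by simp [h1], ⟨hi, h2⟩, ?_⟩
        convert h3 using 1
        abel
    unfold count
    rw [hu, cnt]
    push_cast
    simp_rw [← ih]
    generalize Finset.range (T []).1 = s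
    induction s using Finset.induction_on with
    | empty => simp
    | insert j s hj ihs =>
      rw [Finset.set_biUnion_insert, Finset.sum_insert hj, Set.encard_union_eq, ihs]
      · congr 1
        rw [Function.Injective.encard_image]
        · rfl
        · exact fun _ _ h => List.append_cancel_right h
      · rw [Set.disjoint_left]
        rintro _ ⟨v, -, rfl⟩ h
        simp only [Set.mem_iUnion, Set.mem_image, exists_prop] at h
        obtain ⟨i, hi, w, -, h⟩ := h
        have := (List.append_inj' h rfl).2
        simp at this
        exact hj (this ▸ hi)

variable {A}

lemma measurable_sum_range {α : Type*} [MeasurableSpace α] {N : α → ℕ} (hN : Measurable N)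
    {f : ℕ → α → ℕ} (hf : ∀ i, Measurable (f i)) :
    Measurable fun a => ∑ i ∈ Finset.range (N a), f i a := by
  have : Measurable fun q : ℕ × α => ∑ i ∈ Finset.range q.1, f i q.2 :=
    measurable_from_prod_countable_right fun n =>
      Finset.measurable_sum (Finset.range n) fun i _ => hf i
  exact this.comp (hN.prodMk measurable_id)

lemma measurable_cnt (hA : MeasurableSet A) (n : ℕ) :
    Measurable fun q : MarkedTree d × E d => cnt A n q.1 q.2 := by
  induction n with
  | zero =>
    simp only [cnt]
    exact Measurable.ite (measurable_snd hA) measurable_const measurable_const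
  | succ n ih =>
    simp only [cnt]
    refine measurable_sum_range (by fun_prop) fun i => ?_
    exact ih.comp (((measurable_subtree [i]).comp measurable_fst).prodMk (by fun_prop))

lemma measurable_childCnt (hA : MeasurableSet A) (n : ℕ) :
    Measurable fun q : MarkedTree d × E d => childCnt A n q.1 q.2 :=
  by
  have : Measurable fun q : MarkedTree d × E d => (q.1, q.2 + (q.1 []).2) := by fun_prop
  exact (measurable_cnt hA n).comp this

lemma Measurable.cnt {α : Type*} [MeasurableSpace α] (hA : MeasurableSet A) (n : ℕ)
    {f : α → MarkedTree d} {g : α → E d} (hf : Measurable f) (hg : Measurable g) :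
    Measurable fun a => cnt A n (f a) (g a) :=
  (measurable_cnt hA n).comp (hf.prodMk hg)

lemma Measurable.childCnt {α : Type*} [MeasurableSpace α] (hA : MeasurableSet A) (n : ℕ)
    {f : α → MarkedTree d} {g : α → E d} (hf : Measurable f) (hg : Measurable g) :
    Measurable fun a => childCnt A n (f a) (g a) :=
  (measurable_childCnt hA n).comp (hf.prodMk hg)

end Count

/-! ### Recursions for the number of particles -/

section Recursion

lemma lintegral_pmf (μ : PMF ℕ) (f : ℕ → ℝ≥0∞) :
    ∫⁻ k, f k ∂μ.toMeasure = ∑' k, f k * μ k := by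
  rw [lintegral_countable']
  simp_rw [PMF.toMeasure_apply_singleton _ _ (measurableSet_singleton _)]

/-- The derivative of the generating function of the offspring law. -/
def offspringDeriv (μ : PMF ℕ) (q : ℝ≥0∞) : ℝ≥0∞ := ∫⁻ k, (k : ℝ≥0∞) * q ^ (k - 1) ∂μ.toMeasure

lemma measurable_offspringDeriv (μ : PMF ℕ) : Measurable (offspringDeriv μ) :=
  Measurable.lintegral_prod_right' (f := fun q : ℝ≥0∞ × ℕ => (q.2 : ℝ≥0∞) * q.1 ^ (q.2 - 1)) <|
    measurable_from_prod_countable_left fun k => by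
      simpa using (measurable_id.pow_const (k - 1)).const_mul (k : ℝ≥0∞)

/-- The product rule for the derivative of ∏ τ^{m i}, in a form that factorises over independent
subtrees. Truncated subtraction is harmless: a term with m i = 0 vanishes through its factor m i. -/
lemma sum_mul_pow_sum {ι : Type*} (s : Finset ι) (m : ι → ℕ) (τ : ℝ≥0∞) [DecidableEq ι] :
    ((∑ i ∈ s, m i : ℕ) : ℝ≥0∞) * τ ^ (∑ i ∈ s, m i - 1) =
      ∑ i ∈ s, ∏ j ∈ s, if j = i then (m j : ℝ≥0∞) * τ ^ (m j - 1) else τ ^ (m j) := by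
  push_cast
  rw [Finset.sum_mul]
  refine Finset.sum_congr rfl fun i hi => ?_
  rw [← Finset.mul_prod_erase s _ hi, if_pos rfl, mul_assoc]
  rcases Nat.eq_zero_or_pos (m i) with h | h
  · simp [h]
  · congr 1
    rw [Finset.prod_congr rfl fun j hj => if_neg (Finset.ne_of_mem_erase hj),
      Finset.prod_pow_eq_pow_sum, ← pow_add]
    congr 1
    have := Finset.add_sum_erase s m hi
    omega

variable {d : ℕ} (μ : PMF ℕ) (P : Measure (E d))

/-- The transition operator of the random walk with motion law `P`. -/
def transfer (f : E d → ℝ≥0∞) (x : E d) : ℝ≥0∞ := ∫⁻ ρ, f (x + ρ) ∂P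

lemma transfer_mono {f g : E d → ℝ≥0∞} (h : ∀ x, f x ≤ g x) (x : E d) :
    transfer P f x ≤ transfer P g x := lintegral_mono fun _ => h _

variable [IsProbabilityMeasure P]

variable (A : Set (E d))

/-- Expectation of a function of the number of particles. -/
def expCnt (Φ : ℕ → ℝ≥0∞) (n : ℕ) (x : E d) : ℝ≥0∞ := ∫⁻ T, Φ (cnt A n T x) ∂(bpLaw μ P)

/-- The generating function of the number of particles descending from a child of a particle
located at `x`. -/
def childGen (τ : ℝ≥0∞) (n : ℕ) (x : E d) : ℝ≥0∞ := ∫⁻ T, τ ^ (childCnt A n T x) ∂(bpLaw μ P)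

/-- The derivative with respect to `τ` of the generating function of the number of particles. -/
def genDeriv (τ : ℝ≥0∞) (n : ℕ) (x : E d) : ℝ≥0∞ :=
  expCnt μ P A (fun m => (m : ℝ≥0∞) * τ ^ (m - 1)) n x

/-- The probability that some particle of generation `n` lies in `A`. -/
def hit (n : ℕ) (x : E d) : ℝ≥0∞ := expCnt μ P A (fun m => if m = 0 then 0 else 1) n x

variable {A}

lemma measurable_transfer {f : E d → ℝ≥0∞} (hf : Measurable f) : Measurable (transfer P f) :=
  Measurable.lintegral_prod_right' (f := fun q : E d × E d => f (q.1 + q.2)) (by fun_prop)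

lemma measurable_expCnt (hA : MeasurableSet A) (Φ : ℕ → ℝ≥0∞) (n : ℕ) :
    Measurable (expCnt μ P A Φ n) :=
  Measurable.lintegral_prod_left' (f := fun q : MarkedTree d × E d => Φ (cnt A n q.1 q.2))
    (measurable_from_top.comp (measurable_cnt hA n))

lemma lintegral_childCnt (hA : MeasurableSet A) (Φ : ℕ → ℝ≥0∞) (n : ℕ) (x : E d) :
    ∫⁻ T, Φ (childCnt A n T x) ∂(bpLaw μ P) = transfer P (expCnt μ P A Φ n) x := by
  -- The displacement of the root is independent of its number of children and of the subtrees above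
  -- them, so it can be integrated separately; only this is proved, for a general functional H.
  suffices h : ∀ H : ℕ × (ℕ → MarkedTree d) × E d → ℝ≥0∞, Measurable H →
      ∫⁻ T, H ((split T).1.1, (split T).2, x + (split T).1.2) ∂(bpLaw μ P) =
        ∫⁻ ρ, ∫⁻ T, H ((split T).1.1, (split T).2, x + ρ) ∂(bpLaw μ P) ∂P by
    cases n with
    | zero =>
      exact h (fun q => Φ (cnt A 0 (fun _ => 0) q.2.2)) (measurable_from_top.comp
        (Measurable.cnt hA 0 measurable_const (by fun_prop)))
    | succ n =>
      have hH : Measurable fun q : ℕ × (ℕ → MarkedTree d) × E d =>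
          Φ (∑ i ∈ Finset.range q.1, childCnt A n (q.2.1 i) q.2.2) :=
        measurable_from_top.comp (measurable_sum_range (by fun_prop) fun i =>
          Measurable.childCnt hA n (by fun_prop) (by fun_prop))
      simp only [childCnt, expCnt, transfer, cnt_succ]
      exact h _ hH
  intro H hH
  rw [lintegral_split μ P (F := fun q => H (q.1.1, q.2, x + q.1.2)) (by fun_prop)]
  have h2 : ∀ ρ, ∫⁻ T, H ((split T).1.1, (split T).2, x + ρ) ∂(bpLaw μ P) =
      ∫⁻ N, ∫⁻ f, H (N, f, x + ρ) ∂(Measure.infinitePi fun _ : ℕ => bpLaw μ P) ∂μ.toMeasure := by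
    intro ρ
    rw [lintegral_split μ P (F := fun q => H (q.1.1, q.2, x + ρ)) (by fun_prop), lintegral_prod]
    · simp
    · exact (Measurable.lintegral_prod_right' (f := fun q : (ℕ × E d) × (ℕ → MarkedTree d) =>
        H (q.1.1, q.2, x + ρ)) (by fun_prop)).aemeasurable
  simp_rw [h2]
  rw [lintegral_prod_symm]
  exact (Measurable.lintegral_prod_right' (f := fun q : (ℕ × E d) × (ℕ → MarkedTree d) =>
    H (q.1.1, q.2, x + q.1.2)) (by fun_prop)).aemeasurable

lemma lintegral_fst_fst (F : ℕ → ℝ≥0∞) :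
    ∫⁻ r : ℕ × E d, F r.1 ∂(μ.toMeasure.prod P) = ∫⁻ N, F N ∂μ.toMeasure := by
  rw [lintegral_prod _ (by fun_prop)]
  simp

lemma expCnt_succ (hA : MeasurableSet A) (Φ : ℕ → ℝ≥0∞) (n : ℕ) (x : E d) :
    expCnt μ P A Φ (n + 1) x = ∫⁻ N, ∫⁻ f, Φ (∑ i ∈ Finset.range N, childCnt A n (f i) x)
      ∂(Measure.infinitePi fun _ : ℕ => bpLaw μ P) ∂μ.toMeasure := by
  have hH : Measurable fun q : (ℕ × E d) × (ℕ → MarkedTree d) =>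
      Φ (∑ i ∈ Finset.range q.1.1, childCnt A n (q.2 i) x) :=
    measurable_from_top.comp (measurable_sum_range (by fun_prop) fun i =>
      Measurable.childCnt hA n (by fun_prop) (by fun_prop))
  simp only [expCnt, cnt_succ]
  rw [lintegral_split μ P hH]
  exact lintegral_fst_fst μ P fun N => ∫⁻ f, Φ (∑ i ∈ Finset.range N, childCnt A n (f i) x)
    ∂(Measure.infinitePi fun _ : ℕ => bpLaw μ P)

lemma measurable_childCnt_left (hA : MeasurableSet A) (n : ℕ) (x : E d) :
    Measurable fun T => childCnt A n T x :=
  Measurable.childCnt hA n measurable_id measurable_const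

lemma measurable_cnt_left (hA : MeasurableSet A) (n : ℕ) (x : E d) :
    Measurable fun T => cnt A n T x :=
  Measurable.cnt hA n measurable_id measurable_const

/-- The chain rule for the generating function, obtained without differentiating: by the product
rule each of the N children contributes one derivative factor and N - 1 plain generating functions.
-/
lemma genDeriv_succ (hA : MeasurableSet A) (τ : ℝ≥0∞) (n : ℕ) (x : E d) :
    genDeriv μ P A τ (n + 1) x =
      offspringDeriv μ (childGen μ P A τ n x) * transfer P (genDeriv μ P A τ n) x := by
  have hm := measurable_childCnt_left hA n x
  rw [genDeriv, expCnt_succ μ P hA, offspringDeriv,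
    ← lintegral_mul_const _ measurable_from_top]
  refine lintegral_congr fun N => ?_
  simp_rw [sum_mul_pow_sum]
  have hX : ∀ i j : ℕ, Measurable fun T : MarkedTree d => if j = i then
      (childCnt A n T x : ℝ≥0∞) * τ ^ (childCnt A n T x - 1) else τ ^ childCnt A n T x := by
    intro i j
    split_ifs
    · exact (measurable_from_top (f := fun m : ℕ => (m : ℝ≥0∞) * τ ^ (m - 1))).comp hm
    · exact (measurable_from_top (f := fun m : ℕ => τ ^ m)).comp hm
  refine (lintegral_finsetSum _ fun i _ => Finset.measurable_prod _ fun j _ =>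
    (hX i j).comp (measurable_pi_apply j)).trans ?_
  refine (Finset.sum_congr rfl fun i _ =>
    lintegral_prod_infinitePi (bpLaw μ P) (Finset.range N) (hX i)).trans ?_
  have hval : ∀ i ∈ Finset.range N, ∏ j ∈ Finset.range N, ∫⁻ T : MarkedTree d, (if j = i then
      (childCnt A n T x : ℝ≥0∞) * τ ^ (childCnt A n T x - 1) else τ ^ childCnt A n T x)
      ∂(bpLaw μ P) = childGen μ P A τ n x ^ (N - 1) * transfer P (genDeriv μ P A τ n) x := by
    intro i hi
    rw [← Finset.mul_prod_erase _ _ hi, mul_comm]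
    congr 1
    · rw [Finset.prod_congr rfl (g := fun _ => childGen μ P A τ n x), Finset.prod_const,
        Finset.card_erase_of_mem hi, Finset.card_range]
      intro j hj
      simp [Finset.ne_of_mem_erase hj, childGen]
    · simp only [if_true]
      exact lintegral_childCnt μ P hA (fun m => (m : ℝ≥0∞) * τ ^ (m - 1)) n x
  rw [Finset.sum_congr rfl hval]
  simp [mul_assoc]

lemma genDeriv_zero (τ : ℝ≥0∞) : genDeriv μ P A τ 0 = A.indicator 1 := by
  ext x
  by_cases h : x ∈ A <;> simp [genDeriv, expCnt, cnt, h]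

lemma hit_zero : hit μ P A 0 = A.indicator 1 := by
  ext x
  by_cases h : x ∈ A <;> simp [hit, expCnt, cnt, h]

lemma hit_le_one (n : ℕ) (x : E d) : hit μ P A n x ≤ 1 := by
  refine (lintegral_mono (g := fun _ => 1) fun T => ?_).trans (by simp)
  dsimp only
  split_ifs <;> simp

lemma transfer_hit_le_one (n : ℕ) (x : E d) : transfer P (hit μ P A n) x ≤ 1 :=
  (transfer_mono P (hit_le_one μ P n) x).trans (by simp [transfer])

lemma hit_succ (hA : MeasurableSet A) (n : ℕ) (x : E d) :
    hit μ P A (n + 1) x =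
      ∫⁻ N, (1 - (1 - transfer P (hit μ P A n) x) ^ N) ∂μ.toMeasure := by
  -- Avoiding A is the value at τ = 0 of the generating function, with 0 ^ 0 = 1, and this value
  -- factorises over the children.
  have hΦ : ∀ m : ℕ, (if m = 0 then (0 : ℝ≥0∞) else 1) = 1 - 0 ^ m := by
    intro m
    rcases Nat.eq_zero_or_pos m with h | h
    · simp [h]
    · simp [h.ne']
  have hm := measurable_childCnt_left hA n x
  have h0 : ∫⁻ T, (0 : ℝ≥0∞) ^ (childCnt A n T x) ∂(bpLaw μ P) =
      1 - transfer P (hit μ P A n) x := by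
    unfold hit
    rw [← lintegral_childCnt μ P hA]
    nth_rewrite 1 [← measure_univ (μ := bpLaw μ P), ← lintegral_one]
    rw [← lintegral_sub]
    · refine lintegral_congr fun T => ?_
      rw [hΦ]
      rcases Nat.eq_zero_or_pos (childCnt A n T x) with h | h
      · simp [h]
      · simp [h.ne']
    · exact (measurable_from_top (f := fun m : ℕ => if m = 0 then (0 : ℝ≥0∞) else 1)).comp hm
    · refine ne_top_of_le_ne_top ENNReal.one_ne_top
        ((lintegral_mono (g := fun _ => 1) fun T => ?_).trans (by simp))
      dsimp only
      split_ifs <;> simp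
    · refine ae_of_all _ fun T => ?_
      dsimp only
      split_ifs <;> simp
  rw [hit, expCnt_succ μ P hA]
  refine lintegral_congr fun N => ?_
  have hX : Measurable fun T : MarkedTree d => (0 : ℝ≥0∞) ^ (childCnt A n T x) :=
    (measurable_from_top (f := fun m : ℕ => (0 : ℝ≥0∞) ^ m)).comp hm
  have hN := lintegral_prod_infinitePi (bpLaw μ P) (Finset.range N) fun _ : ℕ => hX
  rw [Finset.prod_const, Finset.card_range, h0] at hN
  rw [← hN]
  simp_rw [hΦ, ← Finset.prod_pow_eq_pow_sum]
  rw [lintegral_sub]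
  · simp
  · exact Finset.measurable_prod _ fun i _ => hX.comp (measurable_pi_apply i)
  · rw [hN]
    exact ENNReal.pow_ne_top (by simp)
  · refine ae_of_all _ fun f => Finset.prod_le_one' fun i _ => ?_
    exact pow_le_one' (by simp) _

lemma one_sub_pow_le (h : ℝ≥0∞) (h1 : h ≤ 1) (N : ℕ) : 1 - (1 - h) ^ N ≤ N * h := by
  obtain ⟨r, hr, rfl⟩ : ∃ r : ℝ, 0 ≤ r ∧ h = ENNReal.ofReal r :=
    ⟨h.toReal, ENNReal.toReal_nonneg, (ENNReal.ofReal_toReal (by aesop)).symm⟩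
  have hr1 : r ≤ 1 := by simpa using h1
  rw [← ENNReal.ofReal_one, ← ENNReal.ofReal_sub _ hr, ← ENNReal.ofReal_pow (by linarith),
    ← ENNReal.ofReal_sub _ (by have := sub_nonneg.2 hr1; positivity), ← ENNReal.ofReal_natCast,
    ← ENNReal.ofReal_mul (by positivity)]
  apply ENNReal.ofReal_le_ofReal
  have := one_add_mul_le_pow (a := -r) (by linarith) N
  rw [← sub_eq_add_neg] at this
  linarith

/-- Second-order counterpart of Bernoulli's inequality, by induction on N. The optimal constant is
not needed, only an error of order N² h², controlled by the second moment. -/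
lemma le_one_sub_pow (h : ℝ≥0∞) (h1 : h ≤ 1) (N : ℕ) :
    N * h ≤ 1 - (1 - h) ^ N + (N : ℝ≥0∞) ^ 2 * h ^ 2 := by
  obtain ⟨r, hr, rfl⟩ : ∃ r : ℝ, 0 ≤ r ∧ h = ENNReal.ofReal r :=
    ⟨h.toReal, ENNReal.toReal_nonneg, (ENNReal.ofReal_toReal (by aesop)).symm⟩
  have hr1 : r ≤ 1 := by simpa using h1
  have hr0 : 0 ≤ 1 - r := sub_nonneg.2 hr1
  rw [← ENNReal.ofReal_one, ← ENNReal.ofReal_sub _ hr, ← ENNReal.ofReal_pow (by linarith),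
    ← ENNReal.ofReal_sub _ (by positivity), ← ENNReal.ofReal_natCast,
    ← ENNReal.ofReal_mul (by positivity), ← ENNReal.ofReal_pow hr,
    ← ENNReal.ofReal_pow (by positivity), ← ENNReal.ofReal_mul (by positivity),
    ← ENNReal.ofReal_add (sub_nonneg.2 (pow_le_one₀ hr0 (by linarith))) (by positivity)]
  apply ENNReal.ofReal_le_ofReal
  suffices (1 - r) ^ N ≤ 1 - N * r + N ^ 2 * r ^ 2 by linarith
  induction N with
  | zero => simp
  | succ N ih =>
    rw [pow_succ]
    refine (mul_le_mul_of_nonneg_right ih hr0).trans ?_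
    push_cast
    have : 0 ≤ (N : ℝ) ^ 2 * r ^ 2 * r := by positivity
    have : 0 ≤ (N : ℝ) * r ^ 2 := by positivity
    nlinarith [sq_nonneg r]

lemma lintegral_offspring (hμ : IsCritical μ) : ∫⁻ N, (N : ℝ≥0∞) ∂μ.toMeasure = 1 := by
  rw [lintegral_pmf]
  exact hμ

lemma hit_succ_le (hμ : IsCritical μ) (hA : MeasurableSet A) (n : ℕ) (x : E d) :
    hit μ P A (n + 1) x ≤ transfer P (hit μ P A n) x := by
  rw [hit_succ μ P hA]
  refine (lintegral_mono fun N => one_sub_pow_le _ (transfer_hit_le_one μ P n x) N).trans ?_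
  rw [lintegral_mul_const _ (by fun_prop), lintegral_offspring μ hμ, one_mul]

lemma le_hit_succ (hμ : IsCritical μ) (hA : MeasurableSet A) (n : ℕ) (x : E d) :
    transfer P (hit μ P A n) x ≤ hit μ P A (n + 1) x +
      (∑' k : ℕ, (k : ℝ≥0∞) ^ 2 * μ k) * transfer P (hit μ P A n) x ^ 2 := by
  rw [hit_succ μ P hA, ← lintegral_pmf, ← lintegral_mul_const _ (by fun_prop),
    ← lintegral_add_right _ (by fun_prop)]
  refine le_trans ?_ (lintegral_mono fun N => le_one_sub_pow _ (transfer_hit_le_one μ P n x) N)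
  rw [lintegral_mul_const _ (by fun_prop), lintegral_offspring μ hμ, one_mul]

end Recursion

/-! ### The spine decomposition -/

section SpineSteps

/-- The sequence whose first term is `p.1` and whose next terms are those of `p.2`. -/
def consSeq {X : Type*} (p : X × (ℕ → X)) : ℕ → X := fun k => Nat.casesOn k p.1 p.2

lemma measurable_consSeq {X : Type*} [MeasurableSpace X] :
    Measurable (consSeq : X × (ℕ → X) → ℕ → X) := by
  refine measurable_pi_lambda _ fun k => ?_
  cases k with
  | zero => exact measurable_fst
  | succ k => exact (measurable_pi_apply k).comp measurable_snd

lemma map_consSeq {X : Type*} [MeasurableSpace X] (m : Measure X) [IsProbabilityMeasure m] :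
    (m.prod (Measure.infinitePi fun _ : ℕ => m)).map consSeq = Measure.infinitePi fun _ => m := by
  refine map_prod_infinitePi m (o := 0) Nat.succ_injective (fun u => ?_) measurable_consSeq
    (fun _ => rfl) fun _ _ => rfl
  simp [Nat.pos_iff_ne_zero]

lemma lintegral_consSeq {X : Type*} [MeasurableSpace X] (m : Measure X) [IsProbabilityMeasure m]
    {F : X × (ℕ → X) → ℝ≥0∞} (hF : Measurable F) :
    ∫⁻ σ, F (σ 0, fun k => σ (k + 1)) ∂(Measure.infinitePi fun _ : ℕ => m) =
      ∫⁻ a, ∫⁻ σ, F (a, σ) ∂(Measure.infinitePi fun _ : ℕ => m) ∂m := by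
  rw [← map_consSeq m, lintegral_map (by fun_prop) measurable_consSeq, map_consSeq,
    lintegral_prod _ (by exact hF.aemeasurable)]
  rfl

variable (μ : PMF ℕ) (hμ : IsCritical μ)

lemma map_fst_spineStepLaw : (spineStepLaw μ hμ).map Prod.fst = sizeBiased μ hμ := by
  rw [spineStepLaw, PMF.map_bind]
  conv_rhs => rw [← PMF.bind_pure (sizeBiased μ hμ)]
  congr 1
  funext k
  rw [PMF.map_comp]
  exact PMF.map_const _ k

lemma ae_spineStepLaw_lt : ∀ᵐ p ∂(spineStepLaw μ hμ).toMeasure, p.2 < p.1 := by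
  rw [ae_iff, PMF.toMeasure_apply_eq_zero_iff _ MeasurableSet.of_discrete, Set.disjoint_left]
  rintro ⟨k, j⟩ h
  simp only [spineStepLaw, PMF.mem_support_bind_iff, PMF.mem_support_map_iff] at h
  obtain ⟨k', hk', j', hj', h⟩ := h
  obtain ⟨rfl, rfl⟩ := Prod.mk.inj h
  cases k' with
  | zero => exact absurd (show ((0 : ℕ) : ℝ≥0∞) * μ 0 = 0 by simp) ((PMF.mem_support_iff _ _).1 hk')
  | succ k =>
    simp only [uniformChild, PMF.support_uniformOfFinset, Finset.coe_range] at hj'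
    simpa using hj'

/-- The link between the spine and the generating functions: the weight k of the size-biased law,
together with the removal of one child, produces k q^{k-1}. -/
lemma lintegral_spineStepLaw (q : ℝ≥0∞) :
    ∫⁻ p, q ^ ((Finset.range p.1).erase p.2).card ∂(spineStepLaw μ hμ).toMeasure =
      offspringDeriv μ q := by
  have h : ∀ᵐ p ∂(spineStepLaw μ hμ).toMeasure,
      q ^ ((Finset.range p.1).erase p.2).card = q ^ (p.1 - 1) := by
    filter_upwards [ae_spineStepLaw_lt μ hμ] with p hp
    rw [Finset.card_erase_of_mem (Finset.mem_range.2 hp), Finset.card_range]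
  rw [lintegral_congr_ae h, ← lintegral_map (f := fun k : ℕ => q ^ (k - 1)) (by fun_prop)
    measurable_fst, PMF.toMeasure_map _ _ measurable_fst, map_fst_spineStepLaw, lintegral_pmf,
    offspringDeriv, lintegral_pmf]
  refine tsum_congr fun k => ?_
  simp only [sizeBiased, DFunLike.coe]
  ring

end SpineSteps

/-! ### Families of brothers along the spine -/

section Brothers

variable {d : ℕ} (A : Set (E d))

lemma position_spineTree (ω : SpineSpace d) (u : Node) :
    position (spineTree ω) u = position ω.1 u := by
  induction u with
  | nil => rfl
  | cons i u ih => simp [position, ih, spineTree]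

lemma length_spine (ω : SpineSpace d) (k : ℕ) : (spine ω k).length = k := by
  induction k with
  | zero => rfl
  | succ k ih => simp [spine, ih]

lemma exists_spine_eq_append (ω : SpineSpace d) (m k : ℕ) :
    ∃ w, spine ω (m + k) = w ++ spine ω k := by
  induction m with
  | zero => exact ⟨[], by simp⟩
  | succ m ih =>
    obtain ⟨w, hw⟩ := ih
    refine ⟨(ω.2 (m + k)).2 :: w, ?_⟩
    rw [show m + 1 + k = m + k + 1 by ring, spine, hw, List.cons_append]

/-- Ancestors of spine particles are on the spine, so no descendant of an off-spine particle has its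
offspring number replaced. -/
lemma subtree_spineTree (ω : SpineSpace d) {u : Node} (hu : u ≠ spine ω u.length) :
    subtree (spineTree ω) u = subtree ω.1 u := by
  funext v
  have hne : v ++ u ≠ spine ω (v.length + u.length) := by
    intro h
    obtain ⟨w, hw⟩ := exists_spine_eq_append ω v.length u.length
    rw [hw] at h
    exact hu (List.append_inj' h (length_spine ω _).symm).2
  simp [subtree, spineTree, if_neg hne]

/-- The number of particles located in `A - z`, `n` generations after the brothers of the spine
particle `w_{k + 1}`, when the root is located at `y` minus the position of `w_k`. -/
def broCnt (k n : ℕ) (T : MarkedTree d) (σ : ℕ → ℕ × ℕ) (y : E d) : ℕ :=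
  ∑ i ∈ (Finset.range (σ k).1).erase (σ k).2,
    childCnt A n (subtree T (i :: spine (T, σ) k)) (y - position T (spine (T, σ) k))

/-- The index shift of the definition: the term at k + 1 counts descendants, k generations later, of
the brothers of w_{k+2}, whose parent is w_{k+1}. -/
lemma tildeY_succ (ω : SpineSpace d) (k : ℕ) (y : E d) :
    tildeY A ω (k + 1) (y - position (spineTree ω) (spine ω (k + 1))) =
      broCnt A (k + 1) k ω.1 ω.2 y := by
  unfold tildeY broCnt
  push_cast
  have hb : brothers ω (k + 1) = ((Finset.range (ω.2 (k + 1)).1).erase (ω.2 (k + 1)).2).image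
      fun i => i :: spine ω (k + 1) := by
    rw [Finset.image_erase fun i j h => (List.cons.inj h).1]
    simp [brothers, spineTree, length_spine]
    rfl
  rw [hb, Finset.sum_image fun i _ j _ h => (List.cons.inj h).1]
  refine Finset.sum_congr rfl fun i hi => ?_
  rw [subtree_spineTree, count_translate, position_spineTree]
  · simp [childCnt, subtree, spineTree]
  · simp only [List.length_cons, length_spine, spine, ne_eq, List.cons.injEq, and_true]
    exact Finset.ne_of_mem_erase hi

lemma spine_succ (T T' : MarkedTree d) (σ : ℕ → ℕ × ℕ) (k : ℕ) :
    spine (T, σ) (k + 1) = spine (T', fun k => σ (k + 1)) k ++ [(σ 0).2] := by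
  induction k with
  | zero => rfl
  | succ k ih => rw [spine, ih]; rfl

/-- Re-rooting at w_1: the spine loses its first step, and the displacement of w_1 is moved into the
base point. -/
lemma broCnt_succ (k n : ℕ) (T : MarkedTree d) (σ : ℕ → ℕ × ℕ) (y : E d) :
    broCnt A (k + 1) n T σ y = broCnt A k n (subtree T [(σ 0).2]) (fun k => σ (k + 1))
      (y - (subtree T [(σ 0).2] []).2) := by
  unfold broCnt
  rw [spine_succ T (subtree T [(σ 0).2]), position_append_singleton]
  simp_rw [subtree_subtree, sub_sub]
  rfl

lemma broCnt_zero (n : ℕ) (T : MarkedTree d) (σ : ℕ → ℕ × ℕ) (y : E d) :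
    broCnt A 0 n T σ y = ∑ i ∈ (Finset.range (σ 0).1).erase (σ 0).2,
      childCnt A n (subtree T [i]) y := by
  simp [broCnt, spine, position]

variable {A}

lemma measurable_subtree_singleton {α : Type*} [MeasurableSpace α] {f : α → MarkedTree d}
    {j : α → ℕ} (hf : Measurable f) (hj : Measurable j) :
    Measurable fun a => subtree (f a) [j a] := by
  have : Measurable fun q : ℕ × MarkedTree d => subtree q.2 [q.1] :=
    measurable_from_prod_countable_right fun i => measurable_subtree [i]
  exact this.comp (hj.prodMk hf)

lemma measurable_broCnt (hA : MeasurableSet A) (k n : ℕ) :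
    Measurable fun q : (MarkedTree d × (ℕ → ℕ × ℕ)) × E d => broCnt A k n q.1.1 q.1.2 q.2 := by
  induction k with
  | zero =>
    simp only [broCnt_zero]
    have : Measurable fun q : (ℕ × ℕ) × (MarkedTree d × E d) =>
        ∑ i ∈ (Finset.range q.1.1).erase q.1.2, childCnt A n (subtree q.2.1 [i]) q.2.2 :=
      measurable_from_prod_countable_right fun p =>
        Finset.measurable_sum ((Finset.range p.1).erase p.2) fun i _ => Measurable.childCnt hA n
          ((measurable_subtree [i]).comp measurable_fst) measurable_snd
    exact this.comp (f := fun q : (MarkedTree d × (ℕ → ℕ × ℕ)) × E d =>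
      (q.1.2 0, (q.1.1, q.2))) (by fun_prop)
  | succ k ih =>
    simp only [broCnt_succ]
    have h1 : Measurable fun q : (MarkedTree d × (ℕ → ℕ × ℕ)) × E d =>
        subtree q.1.1 [(q.1.2 0).2] :=
      measurable_subtree_singleton (by fun_prop) (by fun_prop)
    have h2 : Measurable fun q : (MarkedTree d × (ℕ → ℕ × ℕ)) × E d =>
        fun k => q.1.2 (k + 1) := by fun_prop
    have h3 : Measurable fun q : (MarkedTree d × (ℕ → ℕ × ℕ)) × E d =>
        q.2 - (subtree q.1.1 [(q.1.2 0).2] []).2 :=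
      measurable_snd.sub (measurable_snd.comp ((measurable_pi_apply []).comp h1))
    exact ih.comp ((h1.prodMk h2).prodMk h3)

end Brothers

/-! ### Expectation along the spine as a functional of the random walk -/

section SpineExpectation

variable {d : ℕ} (μ : PMF ℕ) (P : Measure (E d)) [IsProbabilityMeasure P] (A : Set (E d))
  (τ : ℝ≥0∞)

/-- The weight of `m` consecutive families of brothers, along a spine issued from a particle whose
parent is located at `y`. -/
def broWeight (n m : ℕ) (T : MarkedTree d) (σ : ℕ → ℕ × ℕ) (y : E d) : ℝ≥0∞ :=
  ∏ k ∈ Finset.range m, τ ^ broCnt A k (n + k) T σ (y - (T []).2)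

/-- The expectation of `broWeight`, as a functional of the random walk. -/
def walkWeight : ℕ → ℕ → E d → ℝ≥0∞
  | _, 0 => fun _ => 1
  | n, m + 1 => fun y =>
    ∫⁻ ρ, offspringDeriv μ (childGen μ P A τ n (y - ρ)) * walkWeight (n + 1) m (y - ρ) ∂P

variable {A}

lemma broWeight_succ (n m : ℕ) (T : MarkedTree d) (σ : ℕ → ℕ × ℕ) (y : E d) :
    broWeight A τ n (m + 1) T σ y =
      (∏ i ∈ (Finset.range (σ 0).1).erase (σ 0).2,
        τ ^ childCnt A n (subtree T [i]) (y - (T []).2)) *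
      broWeight A τ (n + 1) m (subtree T [(σ 0).2]) (fun k => σ (k + 1)) (y - (T []).2) := by
  simp_rw [broWeight]
  rw [Finset.prod_range_succ', mul_comm, broCnt_zero, ← Finset.prod_pow_eq_pow_sum]
  congr 1
  refine Finset.prod_congr rfl fun k _ => ?_
  rw [broCnt_succ, show n + (k + 1) = n + 1 + k by ring]

lemma measurable_pow_nat : Measurable fun m : ℕ => τ ^ m := measurable_from_top

lemma measurable_broWeight (hA : MeasurableSet A) (n m : ℕ) :
    Measurable fun q : (MarkedTree d × (ℕ → ℕ × ℕ)) × E d =>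
      broWeight A τ n m q.1.1 q.1.2 q.2 := by
  unfold broWeight
  refine Finset.measurable_prod (Finset.range m) fun k _ => (measurable_pow_nat τ).comp ?_
  exact (measurable_broCnt hA k (n + k)).comp (f := fun q : (MarkedTree d × (ℕ → ℕ × ℕ)) × E d =>
    (q.1, q.2 - (q.1.1 []).2)) (by fun_prop)

lemma measurable_childGen (hA : MeasurableSet A) (n : ℕ) : Measurable (childGen μ P A τ n) :=
  Measurable.lintegral_prod_left' (f := fun q : MarkedTree d × E d => τ ^ childCnt A n q.1 q.2)
    ((measurable_pow_nat τ).comp (measurable_childCnt hA n))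

lemma measurable_walkWeight (hA : MeasurableSet A) (n m : ℕ) :
    Measurable (walkWeight μ P A τ n m) := by
  induction m generalizing n with
  | zero => exact measurable_const
  | succ m ih =>
    have := ih (n + 1)
    have h1 := measurable_childGen μ P τ hA n
    have h2 := measurable_offspringDeriv μ
    exact Measurable.lintegral_prod_right' (f := fun q : E d × E d =>
      offspringDeriv μ (childGen μ P A τ n (q.1 - q.2)) *
        walkWeight μ P A τ (n + 1) m (q.1 - q.2)) (by fun_prop)

lemma measurable_broWeight_left (hA : MeasurableSet A) (n m : ℕ) (σ : ℕ → ℕ × ℕ) (y : E d) :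
    Measurable fun T => broWeight A τ n m T σ y :=
  (measurable_broWeight τ hA n m).comp
    (f := fun T : MarkedTree d => ((T, σ), y)) (by fun_prop)

variable (A) in
/-- The expectation of `broWeight` for a given spine. -/
def expBro (n m : ℕ) (σ : ℕ → ℕ × ℕ) (y : E d) : ℝ≥0∞ :=
  ∫⁻ T, broWeight A τ n m T σ y ∂(bpLaw μ P)

lemma measurable_expBro (hA : MeasurableSet A) (n m : ℕ) :
    Measurable fun q : (ℕ → ℕ × ℕ) × E d => expBro μ P A τ n m q.1 q.2 :=
  Measurable.lintegral_prod_left' (f := fun q : MarkedTree d × ((ℕ → ℕ × ℕ) × E d) =>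
    broWeight A τ n m q.1 q.2.1 q.2.2) ((measurable_broWeight τ hA n m).comp
      (f := fun q : MarkedTree d × ((ℕ → ℕ × ℕ) × E d) => ((q.1, q.2.1), q.2.2)) (by fun_prop))

/-- With the spine frozen, the subtrees of the children are independent: each brother contributes a
generating function, and the subtree of the next spine particle carries the remaining weight. -/
lemma expBro_succ (hA : MeasurableSet A) (n m : ℕ) (σ : ℕ → ℕ × ℕ) (y : E d) :
    expBro μ P A τ n (m + 1) σ y =
      ∫⁻ ρ, childGen μ P A τ n (y - ρ) ^ ((Finset.range (σ 0).1).erase (σ 0).2).card *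
        expBro μ P A τ (n + 1) m (fun k => σ (k + 1)) (y - ρ) ∂P := by
  set S := (Finset.range (σ 0).1).erase (σ 0).2 with hS
  set j := (σ 0).2 with hj
  have hjS : j ∉ S := by simp [hS]
  have hX : ∀ i : ℕ, Measurable fun q : MarkedTree d × E d => if i = j then
      broWeight A τ (n + 1) m q.1 (fun k => σ (k + 1)) q.2 else τ ^ childCnt A n q.1 q.2 := by
    intro i
    split_ifs
    · exact (measurable_broWeight τ hA (n + 1) m).comp
        (f := fun q : MarkedTree d × E d => ((q.1, fun k => σ (k + 1)), q.2)) (by fun_prop)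
    · exact (measurable_pow_nat τ).comp (measurable_childCnt hA n)
  have hF : Measurable fun q : (ℕ × E d) × (ℕ → MarkedTree d) => ∏ i ∈ insert j S,
      if i = j then broWeight A τ (n + 1) m (q.2 i) (fun k => σ (k + 1)) (y - q.1.2)
        else τ ^ childCnt A n (q.2 i) (y - q.1.2) :=
    Finset.measurable_prod _ fun i _ => (hX i).comp
      (f := fun q : (ℕ × E d) × (ℕ → MarkedTree d) => (q.2 i, y - q.1.2)) (by fun_prop)
  -- The spine child j joins its brothers S, so that the whole weight is a single product over
  -- distinct independent subtrees.
  have h1 : ∀ T : MarkedTree d, broWeight A τ n (m + 1) T σ y = ∏ i ∈ insert j S,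
      if i = j then broWeight A τ (n + 1) m ((split T).2 i) (fun k => σ (k + 1))
        (y - (split T).1.2) else τ ^ childCnt A n ((split T).2 i) (y - (split T).1.2) := by
    intro T
    rw [Finset.prod_insert hjS, if_pos rfl, mul_comm, broWeight_succ]
    congr 1
    refine Finset.prod_congr rfl fun i hi => ?_
    rw [if_neg (ne_of_mem_of_not_mem hi hjS)]
    rfl
  unfold expBro
  simp_rw [h1]
  rw [lintegral_split μ P hF]
  have h2 : ∀ z : E d, ∫⁻ f, (∏ i ∈ insert j S, if i = j then
      broWeight A τ (n + 1) m (f i) (fun k => σ (k + 1)) z else τ ^ childCnt A n (f i) z)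
        ∂(Measure.infinitePi fun _ : ℕ => bpLaw μ P) = childGen μ P A τ n z ^ S.card *
          expBro μ P A τ (n + 1) m (fun k => σ (k + 1)) z := by
    intro z
    refine (lintegral_prod_infinitePi (bpLaw μ P) (insert j S) fun i =>
      (hX i).comp (measurable_prodMk_right (y := z))).trans ?_
    rw [Finset.prod_insert hjS, mul_comm]
    congr 1
    · rw [Finset.prod_congr rfl (g := fun _ => childGen μ P A τ n z), Finset.prod_const]
      intro i hi
      simp [ne_of_mem_of_not_mem hi hjS, childGen]
    · simp [expBro]
  simp_rw [h2]
  have hb : Measurable fun z => expBro μ P A τ (n + 1) m (fun k => σ (k + 1)) z :=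
    (measurable_expBro μ P τ hA (n + 1) m).of_uncurry_left
  have hc := measurable_childGen μ P τ hA n
  rw [lintegral_prod]
  · simp only [lintegral_const, measure_univ, mul_one]
    rfl
  · exact Measurable.aemeasurable (by fun_prop)

lemma lintegral_expBro (hμ : IsCritical μ) (hA : MeasurableSet A) (n m : ℕ) (y : E d) :
    ∫⁻ σ, expBro μ P A τ n m σ y
      ∂(Measure.infinitePi fun _ : ℕ => (spineStepLaw μ hμ).toMeasure) =
        walkWeight μ P A τ n m y := by
  induction m generalizing n y with
  | zero => simp [expBro, broWeight, walkWeight]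
  | succ m ih =>
    simp_rw [expBro_succ μ P τ hA]
    have hb := measurable_expBro μ P τ hA (n + 1) m
    have hc := measurable_childGen μ P τ hA n
    simp_rw [walkWeight, ← lintegral_spineStepLaw μ hμ]
    generalize childGen μ P A τ n = c at *
    simp_rw [← ih (n + 1)]
    generalize expBro μ P A τ (n + 1) m = b at *
    have hp : Measurable fun q : (ℕ × ℕ) × E d =>
        c (y - q.2) ^ ((Finset.range q.1.1).erase q.1.2).card :=
      measurable_from_prod_countable_right fun p => by
        dsimp only
        fun_prop
    have hp' : Measurable fun q : ((ℕ × ℕ) × (ℕ → ℕ × ℕ)) × E d =>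
        c (y - q.2) ^ ((Finset.range q.1.1.1).erase q.1.1.2).card :=
      hp.comp (f := fun q : ((ℕ × ℕ) × (ℕ → ℕ × ℕ)) × E d => (q.1.1, q.2)) (by fun_prop)
    have hb' : Measurable fun q : ((ℕ × ℕ) × (ℕ → ℕ × ℕ)) × E d => b q.1.2 (y - q.2) :=
      hb.comp (f := fun q : ((ℕ × ℕ) × (ℕ → ℕ × ℕ)) × E d => (q.1.2, y - q.2)) (by fun_prop)
    have hF := Measurable.lintegral_prod_right' (ν := P) (hp'.mul hb')
    refine (lintegral_consSeq _ hF).trans ?_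
    have h1 : ∀ p : ℕ × ℕ, ∫⁻ σ, ∫⁻ ρ, c (y - ρ) ^ ((Finset.range p.1).erase p.2).card *
          b σ (y - ρ) ∂P ∂(Measure.infinitePi fun _ : ℕ => (spineStepLaw μ hμ).toMeasure) =
        ∫⁻ ρ, c (y - ρ) ^ ((Finset.range p.1).erase p.2).card * ∫⁻ σ, b σ (y - ρ)
          ∂(Measure.infinitePi fun _ : ℕ => (spineStepLaw μ hμ).toMeasure) ∂P := by
      intro p
      rw [lintegral_lintegral_swap]
      · refine lintegral_congr fun ρ => ?_
        rw [lintegral_const_mul]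
        exact hb.comp (by fun_prop : Measurable fun σ : ℕ → ℕ × ℕ => (σ, y - ρ))
      · exact ((hp.comp (f := fun q : (ℕ → ℕ × ℕ) × E d => (p, q.2)) (by fun_prop)).mul
          (hb.comp (f := fun q : (ℕ → ℕ × ℕ) × E d => (q.1, y - q.2)) (by fun_prop))).aemeasurable
    refine (lintegral_congr h1).trans ?_
    rw [lintegral_lintegral_swap]
    · refine lintegral_congr fun ρ => ?_
      rw [lintegral_mul_const _ (by fun_prop)]
    · have hv : Measurable fun z => ∫⁻ σ, b σ z
          ∂(Measure.infinitePi fun _ : ℕ => (spineStepLaw μ hμ).toMeasure) :=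
        Measurable.lintegral_prod_left' hb
      have := hv.comp (f := fun q : (ℕ × ℕ) × E d => y - q.2) (by fun_prop)
      exact (hp.mul this).aemeasurable

/-- The total number of particles located in `A` which descend from the brothers of the first
`K` spine particles after the root. -/
def totalBro (A : Set (E d)) (K : ℕ) (ω : SpineSpace d) (y : E d) : ℕ :=
  ∑ k ∈ Finset.range K, broCnt A (k + 1) k ω.1 ω.2 y

lemma measurable_totalBro (hA : MeasurableSet A) (K : ℕ) :
    Measurable fun q : SpineSpace d × E d => totalBro A K q.1 q.2 :=
  Finset.measurable_sum _ fun k _ => measurable_broCnt hA (k + 1) k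

instance (hμ : IsCritical μ) : IsProbabilityMeasure (spineLaw μ hμ P) := by
  unfold spineLaw
  infer_instance

/-- The brothers of w_1 are not counted in `totalBro`. Hence the tree can be re-rooted at w_1 and
the first spine step discarded, neither of which changes the laws. -/
lemma lintegral_pow_totalBro (hμ : IsCritical μ) (hA : MeasurableSet A) (K : ℕ) (y : E d) :
    ∫⁻ ω, τ ^ totalBro A K ω y ∂(spineLaw μ hμ P) = walkWeight μ P A τ 0 K y := by
  have h1 : ∀ ω : SpineSpace d, τ ^ totalBro A K ω y =
      broWeight A τ 0 K (subtree ω.1 [(ω.2 0).2]) (fun k => ω.2 (k + 1)) y := by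
    intro ω
    simp_rw [totalBro, broWeight, ← Finset.prod_pow_eq_pow_sum, broCnt_succ, zero_add]
  have hm : Measurable fun q : SpineSpace d => τ ^ totalBro A K q y :=
    (measurable_pow_nat τ).comp (measurable_totalBro hA K).of_uncurry_right
  have hb : ∀ σ, Measurable fun T => broWeight A τ 0 K T σ y := fun σ =>
    measurable_broWeight_left τ hA 0 K σ y
  have hF : Measurable fun q : (ℕ × ℕ) × (ℕ → ℕ × ℕ) => expBro μ P A τ 0 K q.2 y :=
    (measurable_expBro μ P τ hA 0 K).comp (f := fun q : (ℕ × ℕ) × (ℕ → ℕ × ℕ) => (q.2, y))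
      (by fun_prop)
  have h2 : ∀ σ : ℕ → ℕ × ℕ, ∫⁻ T, τ ^ totalBro A K (T, σ) y ∂(bpLaw μ P) =
      expBro μ P A τ 0 K (fun k => σ (k + 1)) y := by
    intro σ
    simp_rw [h1]
    exact lintegral_subtree μ P [(σ 0).2] (hb fun k => σ (k + 1))
  rw [spineLaw, lintegral_prod_symm _ hm.aemeasurable]
  simp_rw [h2]
  rw [← lintegral_expBro μ P τ hμ hA]
  refine (lintegral_consSeq (spineStepLaw μ hμ).toMeasure hF).trans ?_
  simp

end SpineExpectation

/-! ### The constant `I_A` as a limit of integrated hitting probabilities -/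

section UnitInterval

lemma lintegral_Icc_pow (m : ℕ) :
    ∫⁻ t in Set.Icc (0 : ℝ) 1, ENNReal.ofReal t ^ m = (1 + (m : ℝ≥0∞))⁻¹ := by
  have h : ∫⁻ t in Set.Icc (0 : ℝ) 1, ENNReal.ofReal t ^ m =
      ∫⁻ t in Set.Icc (0 : ℝ) 1, ENNReal.ofReal (t ^ m) :=
    setLIntegral_congr_fun measurableSet_Icc fun t ht => (ENNReal.ofReal_pow ht.1 m).symm
  rw [h, ← ofReal_integral_eq_lintegral_ofReal, integral_Icc_eq_integral_Ioc,
    ← intervalIntegral.integral_of_le zero_le_one, integral_pow]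
  · rw [one_pow, zero_pow (Nat.succ_ne_zero m), sub_zero, one_div,
      ENNReal.ofReal_inv_of_pos (by positivity), ENNReal.ofReal_add (by positivity) zero_le_one]
    simp [add_comm]
  · exact (continuous_pow m).continuousOn.integrableOn_Icc
  · exact (ae_restrict_iff' measurableSet_Icc).2 (ae_of_all _ fun t ht => pow_nonneg ht.1 m)

lemma lintegral_Icc_mul_pow (m : ℕ) :
    ∫⁻ t in Set.Icc (0 : ℝ) 1, (m : ℝ≥0∞) * ENNReal.ofReal t ^ (m - 1) =
      if m = 0 then 0 else 1 := by
  rw [lintegral_const_mul _ (by fun_prop), lintegral_Icc_pow]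
  rcases m with _ | m
  · simp
  · rw [if_neg (Nat.succ_ne_zero m), Nat.add_sub_cancel, Nat.cast_succ, add_comm]
    exact ENNReal.mul_inv_cancel (by simp) (by finiteness)

end UnitInterval

/-! ### The identity between truncations of I_A and integrated hitting probabilities -/

section Trunc

variable {d : ℕ} (μ : PMF ℕ) (hμ : IsCritical μ) (P : Measure (E d)) (A : Set (E d))

/-- The truncation of `G_A` to the brothers of the first `K` spine particles. -/
def truncG (K : ℕ) (y : E d) : ℝ≥0∞ :=
  ∫⁻ ω, (1 + (totalBro A K ω y : ℝ≥0∞))⁻¹ ∂(spineLaw μ hμ P)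

variable {A}

lemma antitone_totalBro_inv (ω : SpineSpace d) (y : E d) :
    Antitone fun K => (1 + (totalBro A K ω y : ℝ≥0∞))⁻¹ := by
  intro K K' h
  refine ENNReal.inv_le_inv.2 (add_le_add_right (Nat.cast_le.2 ?_) 1)
  exact Finset.sum_le_sum_of_subset (Finset.range_subset_range.2 h)

lemma antitone_truncG (y : E d) : Antitone fun K => truncG μ hμ P A K y :=
  fun _ _ h => lintegral_mono fun ω => antitone_totalBro_inv ω y h

variable [IsProbabilityMeasure P]

lemma measurable_truncG (hA : MeasurableSet A) (K : ℕ) : Measurable (truncG μ hμ P A K) :=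
  Measurable.lintegral_prod_left' (f := fun q : SpineSpace d × E d =>
    (1 + (totalBro A K q.1 q.2 : ℝ≥0∞))⁻¹)
    ((measurable_from_top (f := fun m : ℕ => (1 + (m : ℝ≥0∞))⁻¹)).comp (measurable_totalBro hA K))

lemma truncG_le_one (K : ℕ) (y : E d) : truncG μ hμ P A K y ≤ 1 := by
  refine (lintegral_mono (g := fun _ => 1) fun ω => ?_).trans (by simp)
  exact ENNReal.inv_le_one.2 le_self_add

lemma G_eq_iInf (hA : MeasurableSet A) (y : E d) : G μ hμ P A y = ⨅ K, truncG μ hμ P A K y := by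
  have h : ∀ ω : SpineSpace d, (1 + ∑' k : ℕ,
      ((tildeY A ω (k + 1) (y - position (spineTree ω) (spine ω (k + 1))) : ℕ∞) : ℝ≥0∞))⁻¹ =
      ⨅ K, (1 + (totalBro A K ω y : ℝ≥0∞))⁻¹ := by
    intro ω
    rw [ENNReal.tsum_eq_iSup_nat, ENNReal.add_iSup, ENNReal.inv_iSup]
    simp_rw [tildeY_succ, totalBro]
    simp
  unfold G truncG
  simp_rw [h]
  refine lintegral_iInf (fun K => ?_) (fun K K' h ω => antitone_totalBro_inv ω y h) ?_
  · exact (measurable_from_top (f := fun m : ℕ => (1 + (m : ℝ≥0∞))⁻¹)).comp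
      (measurable_totalBro hA K).of_uncurry_right
  · exact ne_top_of_le_ne_top ENNReal.one_ne_top (truncG_le_one μ hμ P 0 y)

variable (lam : Measure (E d))

lemma tendsto_setLIntegral_truncG (hA : MeasurableSet A) (hfin : lam A ≠ ∞) :
    Tendsto (fun K => ∫⁻ y in A, truncG μ hμ P A K y ∂lam) atTop
      (𝓝 (∫⁻ y in A, G μ hμ P A y ∂lam)) := by
  simp_rw [G_eq_iInf μ hμ P hA]
  rw [lintegral_iInf (fun K => measurable_truncG μ hμ P hA K)
    (fun K K' h y => antitone_truncG μ hμ P y h)]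
  · exact tendsto_atTop_iInf fun K K' h => lintegral_mono fun y => antitone_truncG μ hμ P y h
  · refine ne_top_of_le_ne_top hfin
      ((lintegral_mono fun y => truncG_le_one μ hμ P 0 y).trans (by simp))

variable [SFinite lam] (hinv : ∀ᵐ ρ ∂P, ∀ F : E d → ℝ≥0∞, Measurable F →
  ∫⁻ x, F (x + ρ) ∂lam = ∫⁻ x, F x ∂lam)

include hinv in
-- Duality: by translation invariance of `lam`, the adjoint of the walk operator is that of the
-- reversed walk. This is why `walkWeight` moves by y - ρ.
lemma lintegral_mul_transfer {f g : E d → ℝ≥0∞} (hf : Measurable f) (hg : Measurable g) :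
    ∫⁻ x, f x * transfer P g x ∂lam = ∫⁻ y, (∫⁻ ρ, f (y - ρ) ∂P) * g y ∂lam := by
  have h1 : ∀ x, f x * transfer P g x = ∫⁻ ρ, f x * g (x + ρ) ∂P := fun x =>
    (lintegral_const_mul _ (by fun_prop)).symm
  have h2 : ∀ y, (∫⁻ ρ, f (y - ρ) ∂P) * g y = ∫⁻ ρ, f (y - ρ) * g y ∂P := fun y =>
    (lintegral_mul_const _ (by fun_prop)).symm
  simp_rw [h1, h2]
  refine (lintegral_lintegral_swap (by fun_prop)).trans (Eq.trans (lintegral_congr_ae ?_)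
    (lintegral_lintegral_swap (by fun_prop)))
  filter_upwards [hinv] with ρ hρ
  simpa using hρ (fun y => f (y - ρ) * g y) (by fun_prop)

include hinv in
lemma lintegral_transfer {g : E d → ℝ≥0∞} (hg : Measurable g) :
    ∫⁻ x, transfer P g x ∂lam = ∫⁻ y, g y ∂lam := by
  simpa using lintegral_mul_transfer P lam hinv (f := fun _ => 1) measurable_const hg

include hinv in
-- Duality moves one walk step from the weight to `genDeriv` at time j. The factor `offspringDeriv`
-- left behind is exactly the one that `genDeriv_succ` needs to advance to time j + 1.
lemma lintegral_genDeriv_mul_walkWeight (hA : MeasurableSet A) (τ : ℝ≥0∞) (j m : ℕ) :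
    ∫⁻ x, genDeriv μ P A τ j x * walkWeight μ P A τ j m x ∂lam =
      ∫⁻ x, genDeriv μ P A τ (j + m) x ∂lam := by
  induction m generalizing j with
  | zero => simp [walkWeight]
  | succ m ih =>
    have h1 := measurable_offspringDeriv μ
    have h2 := measurable_childGen μ P τ hA j
    have h3 := measurable_walkWeight μ P τ hA (j + 1) m
    have h4 : Measurable (genDeriv μ P A τ j) := measurable_expCnt μ P hA _ j
    have h := lintegral_mul_transfer P lam hinv (f := fun x =>
      offspringDeriv μ (childGen μ P A τ j x) * walkWeight μ P A τ (j + 1) m x)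
      (by fun_prop) h4
    rw [show j + (m + 1) = j + 1 + m by ring, ← ih (j + 1)]
    simp_rw [genDeriv_succ μ P hA, walkWeight]
    simp_rw [mul_comm (genDeriv μ P A τ j _)]
    rw [← h]
    refine lintegral_congr fun x => ?_
    ring

include hinv in
-- Both integrands are integrals over τ in [0, 1], of E[τ^Y] and of E[Z τ^{Z-1}]. For fixed τ the
-- two space integrals agree by the previous identity started at time 0, where `genDeriv` is the
-- indicator of A.
lemma setLIntegral_truncG (hA : MeasurableSet A) (K : ℕ) :
    ∫⁻ y in A, truncG μ hμ P A K y ∂lam = ∫⁻ x, hit μ P A K x ∂lam := by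
  set I : Measure ℝ := volume.restrict (Set.Icc 0 1)
  have hpow : Measurable fun q : ℝ × ℕ => ENNReal.ofReal q.1 ^ q.2 :=
    measurable_from_prod_countable_left fun m => by dsimp only; fun_prop
  have hmul : Measurable fun q : ℝ × ℕ => (q.2 : ℝ≥0∞) * ENNReal.ofReal q.1 ^ (q.2 - 1) :=
    measurable_from_prod_countable_left fun m => by dsimp only; fun_prop
  have h1 : ∀ y, truncG μ hμ P A K y =
      ∫⁻ t, walkWeight μ P A (ENNReal.ofReal t) 0 K y ∂I := by
    intro y
    simp_rw [truncG, ← lintegral_Icc_pow, ← lintegral_pow_totalBro μ P _ hμ hA]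
    refine lintegral_lintegral_swap (Measurable.aemeasurable ?_)
    exact hpow.comp (f := fun q : SpineSpace d × ℝ => (q.2, totalBro A K q.1 y))
      (measurable_snd.prodMk ((measurable_totalBro hA K).comp
        (f := fun q : SpineSpace d × ℝ => (q.1, y)) (by fun_prop)))
  have h2 : ∀ x, hit μ P A K x = ∫⁻ t, genDeriv μ P A (ENNReal.ofReal t) K x ∂I := by
    intro x
    simp_rw [hit, genDeriv, expCnt, ← lintegral_Icc_mul_pow]
    refine lintegral_lintegral_swap (Measurable.aemeasurable ?_)
    exact hmul.comp (f := fun q : MarkedTree d × ℝ => (q.2, cnt A K q.1 x))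
      (measurable_snd.prodMk ((measurable_cnt_left hA K x).comp measurable_fst))
  simp_rw [h1, h2]
  refine (lintegral_lintegral_swap ?_).trans (Eq.trans (lintegral_congr fun t => ?_)
    (lintegral_lintegral_swap ?_).symm)
  rotate_left
  · have := lintegral_genDeriv_mul_walkWeight μ P lam hinv hA (ENNReal.ofReal t) 0 K
    rw [zero_add, genDeriv_zero] at this
    rw [← this, ← lintegral_indicator hA]
    refine lintegral_congr fun x => ?_
    by_cases hx : x ∈ A <;> simp [hx]
  · refine Measurable.aemeasurable ?_
    exact Measurable.lintegral_prod_left' (f := fun q : MarkedTree d × (E d × ℝ) =>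
      (cnt A K q.1 q.2.1 : ℝ≥0∞) * ENNReal.ofReal q.2.2 ^ (cnt A K q.1 q.2.1 - 1))
      (hmul.comp (f := fun q : MarkedTree d × (E d × ℝ) => (q.2.2, cnt A K q.1 q.2.1))
        ((by fun_prop : Measurable fun q : MarkedTree d × (E d × ℝ) => q.2.2).prodMk
          (Measurable.cnt hA K (by fun_prop) (by fun_prop))))
  · refine Measurable.aemeasurable ?_
    simp_rw [← lintegral_pow_totalBro μ P _ hμ hA]
    exact Measurable.lintegral_prod_left' (f := fun q : SpineSpace d × (E d × ℝ) =>
      ENNReal.ofReal q.2.2 ^ (totalBro A K q.1 q.2.1))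
      (hpow.comp (f := fun q : SpineSpace d × (E d × ℝ) => (q.2.2, totalBro A K q.1 q.2.1))
        ((by fun_prop : Measurable fun q : SpineSpace d × (E d × ℝ) => q.2.2).prodMk
          ((measurable_totalBro hA K).comp (f := fun q : SpineSpace d × (E d × ℝ) =>
            (q.1, q.2.1)) (by fun_prop))))

end Trunc

/-! ### Hitting probabilities and the random walk -/

section Asymptotics

set_option linter.unusedSectionVars false

variable {d : ℕ} (μ : PMF ℕ) (hμ : IsCritical μ) (P : Measure (E d)) [IsProbabilityMeasure P]
  {A : Set (E d)}

lemma measurable_iterate_transfer {f : E d → ℝ≥0∞} (hf : Measurable f) (m : ℕ) :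
    Measurable ((transfer P)^[m] f) := by
  induction m with
  | zero => exact hf
  | succ m ih =>
    rw [Function.iterate_succ_apply']
    exact measurable_transfer P ih

lemma measurable_hit (hA : MeasurableSet A) (n : ℕ) : Measurable (hit μ P A n) :=
  measurable_expCnt μ P hA _ n

include hμ in
lemma hit_add_le (hA : MeasurableSet A) (K m : ℕ) (x : E d) :
    hit μ P A (K + m) x ≤ (transfer P)^[m] (hit μ P A K) x := by
  induction m generalizing x with
  | zero => exact le_rfl
  | succ m ih =>
    rw [Function.iterate_succ_apply']
    exact (hit_succ_le μ P hμ hA (K + m) x).trans (transfer_mono P ih x)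

include hμ in
-- The quadratic error is at most η times the linear term, so the total loss over m steps is a sum
-- of the η's, relative to the walk itself.
lemma iterate_transfer_le_hit (hA : MeasurableSet A) {L : Set (E d)}
    (hL : ∀ x ∈ L, ∀ᵐ ρ ∂P, x + ρ ∈ L) {η : ℕ → ℝ≥0∞}
    (hη : ∀ n, ∀ x ∈ L,
      (∑' k : ℕ, (k : ℝ≥0∞) ^ 2 * μ k) * transfer P (hit μ P A n) x ≤ η n)
    (K m : ℕ) {x : E d} (hx : x ∈ L) :
    (transfer P)^[m] (hit μ P A K) x ≤ hit μ P A (K + m) x +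
      (∑ j ∈ Finset.range m, η (j + K)) * (transfer P)^[m] (hit μ P A K) x := by
  induction m generalizing x with
  | zero => simp
  | succ m ih =>
    rw [Function.iterate_succ_apply']
    set D := ∑ j ∈ Finset.range m, η (j + K)
    set f := (transfer P)^[m] (hit μ P A K)
    have hf : Measurable f := measurable_iterate_transfer P (measurable_hit μ P hA K) m
    have hh := measurable_hit μ P hA (K + m)
    have h1 : transfer P f x ≤ transfer P (hit μ P A (K + m)) x + D * transfer P f x := by
      unfold transfer
      rw [← lintegral_const_mul _ (by fun_prop), ← lintegral_add_left (by fun_prop)]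
      refine lintegral_mono_ae ?_
      filter_upwards [hL x hx] with ρ hρ using ih hρ
    have h2 : transfer P (hit μ P A (K + m)) x ≤
        hit μ P A (K + m + 1) x + η (m + K) * transfer P f x := by
      refine (le_hit_succ μ P hμ hA (K + m) x).trans (add_le_add_right ?_ _)
      rw [pow_two, ← mul_assoc, add_comm m K]
      exact mul_le_mul' (hη _ x hx) (transfer_mono P (hit_add_le μ hμ P hA K m) x)
    calc transfer P f x ≤ hit μ P A (K + m + 1) x + η (m + K) * transfer P f x +
          D * transfer P f x := h1.trans (add_le_add_left h2 _)
      _ = _ := by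
        rw [Finset.sum_range_succ, add_mul, add_comm (D * _), ← add_assoc]
        rfl

include hμ in
-- Otherwise N = 0 almost surely, against mean one. This propagates positivity of the integrated
-- hitting probability from one generation to the next.
lemma transfer_eq_zero_of_hit_succ (hA : MeasurableSet A) (n : ℕ) {x : E d}
    (h : hit μ P A (n + 1) x = 0) : transfer P (hit μ P A n) x = 0 := by
  rw [hit_succ μ P hA, lintegral_eq_zero_iff measurable_from_top] at h
  by_contra h0
  have hN : (fun N : ℕ => (N : ℝ≥0∞)) =ᵐ[μ.toMeasure] 0 := by
    filter_upwards [h] with N hN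
    by_contra hN0
    have hN1 : N ≠ 0 := by rintro rfl; simp at hN0
    have h1 : 1 ≤ (1 - transfer P (hit μ P A n) x) ^ N := tsub_eq_zero_iff_le.1 hN
    have h2 := h1.trans (pow_le_of_le_one (zero_le) tsub_le_self hN1)
    exact absurd h2 (not_le.2 (ENNReal.sub_lt_self ENNReal.one_ne_top one_ne_zero h0))
  have h1 := lintegral_offspring μ hμ
  rw [lintegral_congr_ae hN] at h1
  simp at h1

/-- The hypotheses of the local limit theorem, for a random walk with values in `L` whose marginal
laws have the densities `h m` with respect to `lam`. -/
structure LocalLimit (P : Measure (E d)) (lam : Measure (E d)) (L : Set (E d))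
    (h : ℕ → E d → ℝ≥0∞) (C : ℝ≥0∞) (an : ℕ → E d) (g : ℝ≥0∞) : Prop where
  step_mem : ∀ x ∈ L, ∀ᵐ ρ ∂P, x + ρ ∈ L
  ae_mem : ∀ᵐ x ∂lam, x ∈ L
  an_mem : ∀ n, an n ∈ L
  invariant : ∀ᵐ ρ ∂P, ∀ F : E d → ℝ≥0∞, Measurable F → ∫⁻ x, F (x + ρ) ∂lam = ∫⁻ x, F x ∂lam
  measurable : ∀ m, Measurable (h m)
  density : ∀ m, 1 ≤ m → ∀ f : E d → ℝ≥0∞, Measurable f → ∀ x ∈ L,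
    (transfer P)^[m] f x = ∫⁻ y, h m (y - x) * f y ∂lam
  bound_ne_top : C ≠ ∞
  bound : ∀ (m : ℕ) (z : E d), ENNReal.ofReal ((m : ℝ) ^ ((d : ℝ) / 2)) * h m z ≤ C
  limit : ∀ K, ∀ᵐ y ∂lam,
    Tendsto (fun m : ℕ => ENNReal.ofReal ((m : ℝ) ^ ((d : ℝ) / 2)) * h m (y - an (K + m)))
      atTop (𝓝 g)
  limit_ne_top : g ≠ ∞

variable {P} {lam : Measure (E d)} [SFinite lam] {L : Set (E d)} {h : ℕ → E d → ℝ≥0∞} {C : ℝ≥0∞}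
  {an : ℕ → E d} {g : ℝ≥0∞}

lemma tendsto_rpow_ratio (s : ℝ) (K : ℕ) :
    Tendsto (fun m : ℕ => ((K + m : ℕ) : ℝ) ^ s / (m : ℝ) ^ s) atTop (𝓝 1) := by
  have h1 : Tendsto (fun m : ℕ => ((K : ℝ) / m + 1) ^ s) atTop (𝓝 1) := by
    have := ((tendsto_const_div_atTop_nhds_zero_nat (K : ℝ)).add_const 1).rpow_const
      (p := s) (Or.inl (by simp))
    simpa using this
  refine h1.congr' ?_
  filter_upwards [eventually_gt_atTop 0] with m hm
  have : (0 : ℝ) < m := by exact_mod_cast hm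
  rw [← Real.div_rpow (by positivity) this.le]
  congr 1
  push_cast
  field_simp

/-- Dominated convergence with majorant C f. The walk makes m steps but the normalisation is at time
K + m; the ratio of the two powers tends to 1. -/
lemma LocalLimit.tendsto_iterate (H : LocalLimit P lam L h C an g) {f : E d → ℝ≥0∞}
    (hf : Measurable f) (hfin : ∫⁻ x, f x ∂lam ≠ ∞) (K : ℕ) :
    Tendsto (fun m : ℕ => ENNReal.ofReal (((K + m : ℕ) : ℝ) ^ ((d : ℝ) / 2)) *
      (transfer P)^[m] f (an (K + m))) atTop (𝓝 (g * ∫⁻ x, f x ∂lam)) := by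
  set s : ℝ := (d : ℝ) / 2
  have hC := H.bound_ne_top
  have h1 : Tendsto (fun m : ℕ => ∫⁻ y, (ENNReal.ofReal ((m : ℝ) ^ s) * h m (y - an (K + m))) * f y
      ∂lam) atTop (𝓝 (∫⁻ y, g * f y ∂lam)) := by
    refine tendsto_lintegral_of_dominated_convergence (fun y => C * f y) (fun m => ?_)
      (fun m => ae_of_all _ fun y => mul_le_mul_left (H.bound m _) _) ?_ ?_
    · have := H.measurable m
      fun_prop
    · rw [lintegral_const_mul _ hf]
      finiteness
    · have hfae := ae_lt_top hf hfin
      filter_upwards [H.limit K, hfae] with y hy hfy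
      exact ENNReal.Tendsto.mul_const hy (Or.inr hfy.ne)
  rw [lintegral_const_mul _ hf] at h1
  have h2 := ENNReal.tendsto_ofReal (tendsto_rpow_ratio s K)
  have h3 := ENNReal.Tendsto.mul h2 (by simp) h1 (by simp)
  rw [ENNReal.ofReal_one, one_mul] at h3
  refine h3.congr' ?_
  filter_upwards [eventually_gt_atTop 0] with m hm
  have hm0 : (0 : ℝ) < (m : ℝ) ^ s := Real.rpow_pos_of_pos (by exact_mod_cast hm) s
  rw [H.density m hm f hf _ (H.an_mem _)]
  simp_rw [mul_assoc]
  have := H.measurable m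
  rw [lintegral_const_mul _ (by fun_prop), ← mul_assoc, ← ENNReal.ofReal_mul (by positivity),
    div_mul_cancel₀ _ hm0.ne']

lemma LocalLimit.lintegral_iterate (H : LocalLimit P lam L h C an g) {f : E d → ℝ≥0∞}
    (hf : Measurable f) (m : ℕ) : ∫⁻ x, (transfer P)^[m] f x ∂lam = ∫⁻ x, f x ∂lam := by
  induction m with
  | zero => rfl
  | succ m ih =>
    rw [Function.iterate_succ_apply', lintegral_transfer P lam H.invariant
      (measurable_iterate_transfer P hf m), ih]

lemma LocalLimit.iterate_le (H : LocalLimit P lam L h C an g) (hA : MeasurableSet A) {m : ℕ}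
    (hm : 1 ≤ m) {x : E d} (hx : x ∈ L) :
    (transfer P)^[m] (A.indicator 1) x ≤
      C * lam A * (ENNReal.ofReal ((m : ℝ) ^ ((d : ℝ) / 2)))⁻¹ := by
  have hm0 : (0 : ℝ) < (m : ℝ) ^ ((d : ℝ) / 2) := Real.rpow_pos_of_pos (by exact_mod_cast hm) _
  rw [H.density m hm _ (measurable_one.indicator hA) x hx]
  calc ∫⁻ y, h m (y - x) * A.indicator 1 y ∂lam
      ≤ ∫⁻ y, C * (ENNReal.ofReal ((m : ℝ) ^ ((d : ℝ) / 2)))⁻¹ * A.indicator 1 y ∂lam := by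
        refine lintegral_mono fun y => mul_le_mul_left ?_ _
        rw [← div_eq_mul_inv, ENNReal.le_div_iff_mul_le (Or.inl (by simpa using hm0))
          (Or.inl ENNReal.ofReal_ne_top), mul_comm]
        exact H.bound m _
    _ = _ := by
        rw [lintegral_const_mul _ (measurable_one.indicator hA), lintegral_indicator_one hA]
        ring

include hμ in
-- Since `hit` at time n is at most the n-th iterate of the indicator of A, the uniform heat-kernel
-- bound at time n + 1 applies. Summability of (n + 1)^{-d/2} is where d ≥ 3 is essential.
lemma LocalLimit.exists_summable (H : LocalLimit P lam L h C an g) (hd : 3 ≤ d)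
    (h2 : HasSecondMoment μ) (hA : MeasurableSet A) (hfin : lam A ≠ ∞) :
    ∃ η : ℕ → ℝ≥0∞, ∑' n, η n ≠ ∞ ∧ ∀ n, ∀ x ∈ L,
      (∑' k : ℕ, (k : ℝ≥0∞) ^ 2 * μ k) * transfer P (hit μ P A n) x ≤ η n := by
  refine ⟨fun n => (∑' k : ℕ, (k : ℝ≥0∞) ^ 2 * μ k) * (C * lam A) *
    (ENNReal.ofReal (((n + 1 : ℕ) : ℝ) ^ ((d : ℝ) / 2)))⁻¹, ?_, fun n x hx => ?_⟩
  · rw [ENNReal.tsum_mul_left]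
    refine ENNReal.mul_ne_top (ENNReal.mul_ne_top h2.ne (ENNReal.mul_ne_top H.bound_ne_top hfin)) ?_
    have hs : Summable fun n : ℕ => ((((n + 1 : ℕ) : ℝ)) ^ ((d : ℝ) / 2))⁻¹ := by
      refine (summable_nat_add_iff 1).2 (Real.summable_nat_rpow_inv.2 ?_)
      have : (3 : ℝ) ≤ d := by exact_mod_cast hd
      linarith
    have := hs.tsum_ofReal_ne_top
    convert this using 3 with n
    rw [ENNReal.ofReal_inv_of_pos]
    positivity
  · dsimp only
    rw [mul_assoc]
    refine mul_le_mul_right ?_ _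
    refine le_trans ?_ (H.iterate_le hA (m := n + 1) (by omega) hx)
    rw [Function.iterate_succ_apply', ← hit_zero μ P]
    refine transfer_mono P (fun y => ?_) x
    simpa using hit_add_le μ hμ P hA 0 n y

include hμ in
theorem LocalLimit.tendsto_hit (H : LocalLimit P lam L h C an g) (hd : 3 ≤ d)
    (h2 : HasSecondMoment μ) (hA : MeasurableSet A) (hfin : lam A ≠ ∞) (hpos : lam A ≠ 0) :
    Tendsto (fun n : ℕ => ENNReal.ofReal ((n : ℝ) ^ ((d : ℝ) / 2)) * hit μ P A n (an n)) atTop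
      (𝓝 (g * ∫⁻ y in A, G μ hμ P A y ∂lam)) ∧
    ∫⁻ y in A, G μ hμ P A y ∂lam ≠ 0 ∧ ∫⁻ y in A, G μ hμ P A y ∂lam ≠ ∞ := by
  obtain ⟨η, hη, hηle⟩ := H.exists_summable μ hμ hd h2 hA hfin
  set D : ℕ → ℝ≥0∞ := fun K => ∑' j, η (j + K)
  have hD : Tendsto D atTop (𝓝 0) := ENNReal.tendsto_sum_nat_add η hη
  have hDtop : ∀ K, D K ≠ ∞ := fun K =>
    ne_top_of_le_ne_top hη (ENNReal.tsum_comp_le_tsum_of_injective (add_left_injective K) η)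
  set J : ℕ → ℝ≥0∞ := fun K => ∫⁻ x, hit μ P A K x ∂lam
  set I := ∫⁻ y in A, G μ hμ P A y ∂lam
  have hJ : Tendsto J atTop (𝓝 I) := by
    simpa only [setLIntegral_truncG μ hμ P lam H.invariant hA] using
      tendsto_setLIntegral_truncG μ hμ P lam hA hfin
  have hmeas := measurable_hit μ P hA
  have hJle : ∀ K m, J (K + m) ≤ J K := fun K m => by
    simp only [J]
    rw [← H.lintegral_iterate (hmeas K) m]
    exact lintegral_mono (hit_add_le μ hμ P hA K m)
  have hJ0 : J 0 = lam A := by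
    simp only [J]
    rw [hit_zero μ P, lintegral_indicator_one hA]
  have hJtop : ∀ K, J K ≠ ∞ := fun K => by
    refine ne_top_of_le_ne_top hfin ?_
    rw [← hJ0]
    simpa using hJle 0 K
  have hlow : ∀ K m x, x ∈ L → (transfer P)^[m] (hit μ P A K) x ≤ hit μ P A (K + m) x +
      D K * (transfer P)^[m] (hit μ P A K) x := fun K m x hx =>
    (iterate_transfer_le_hit μ hμ P hA H.step_mem hηle K m hx).trans
      (add_le_add_right (mul_le_mul_left (ENNReal.sum_le_tsum _) _) _)
  have hItop : I ≠ ∞ := ne_top_of_le_ne_top (hJtop 0)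
    (le_of_tendsto hJ (Eventually.of_forall fun K => by simpa using hJle 0 K))
  refine ⟨?_, ?_, hItop⟩
  -- For each fixed K the sandwich bounds limsup and liminf by g J_K and (1 - D_K) g J_K; then K
  -- tends to infinity.
  · have hup : ∀ K, limsup (fun n : ℕ => ENNReal.ofReal ((n : ℝ) ^ ((d : ℝ) / 2)) *
        hit μ P A n (an n)) atTop ≤ g * J K := by
      intro K
      rw [← limsup_nat_add _ K, ← (H.tendsto_iterate (hmeas K) (hJtop K) K).limsup_eq]
      refine limsup_le_limsup (Eventually.of_forall fun m => ?_)
      dsimp only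
      rw [add_comm m K]
      exact mul_le_mul_right (hit_add_le μ hμ P hA K m _) _
    have hdown : ∀ K, g * J K - D K * (g * J K) ≤ liminf (fun n : ℕ =>
        ENNReal.ofReal ((n : ℝ) ^ ((d : ℝ) / 2)) * hit μ P A n (an n)) atTop := by
      intro K
      have ht := H.tendsto_iterate (hmeas K) (hJtop K) K
      have ht' := ENNReal.Tendsto.sub ht (ENNReal.Tendsto.const_mul ht (Or.inr (hDtop K)))
        (Or.inl (ENNReal.mul_ne_top H.limit_ne_top (hJtop K)))
      rw [← liminf_nat_add _ K]
      refine ht'.liminf_eq.symm.le.trans ?_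
      refine liminf_le_liminf (Eventually.of_forall fun m => ?_)
      rw [tsub_le_iff_right, add_comm m K, mul_left_comm, ← mul_add]
      exact mul_le_mul_right (hlow K m _ (H.an_mem _)) _
    have hgJ : Tendsto (fun K => g * J K) atTop (𝓝 (g * I)) :=
      ENNReal.Tendsto.const_mul hJ (Or.inr H.limit_ne_top)
    refine tendsto_of_le_liminf_of_limsup_le ?_ (ge_of_tendsto' hgJ hup)
    have h0 := ENNReal.Tendsto.sub hgJ (ENNReal.Tendsto.mul hD
      (Or.inr (ENNReal.mul_ne_top H.limit_ne_top hItop)) hgJ (Or.inr ENNReal.zero_ne_top))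
      (Or.inl (ENNReal.mul_ne_top H.limit_ne_top hItop))
    rw [zero_mul, tsub_zero] at h0
    exact le_of_tendsto' h0 hdown
  -- Positivity of I: integrating the lower bound and letting m tend to infinity gives J K ≤ I + D K
  -- * J K. Were I zero, a K with D K < 1 would contradict 0 < J K < ∞.
  · have hJD : ∀ K m, J K ≤ J (K + m) + D K * J K := by
      intro K m
      have := measurable_iterate_transfer P (hmeas K) m
      simp only [J]
      nth_rewrite 1 2 [← H.lintegral_iterate (hmeas K) m]
      rw [← lintegral_const_mul _ this, ← lintegral_add_left (hmeas _)]
      refine lintegral_mono_ae ?_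
      filter_upwards [H.ae_mem] with x hx using hlow K m x hx
    have hJI : ∀ K, J K ≤ I + D K * J K := fun K => by
      have := ((tendsto_add_atTop_iff_nat K).2 hJ).add_const (D K * J K)
      refine ge_of_tendsto' this fun m => ?_
      rw [add_comm m K]
      exact hJD K m
    have hJpos : ∀ K, J K ≠ 0 := by
      intro K
      induction K with
      | zero => rwa [hJ0]
      | succ K ih =>
        intro h0
        refine ih ?_
        have h1 := (lintegral_eq_zero_iff (hmeas (K + 1))).1 h0
        simp only [J]
        rw [← lintegral_transfer P lam H.invariant (hmeas K), lintegral_eq_zero_iff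
          (measurable_transfer P (hmeas K))]
        filter_upwards [h1] with x hx using transfer_eq_zero_of_hit_succ μ hμ P hA K hx
    intro hI0
    obtain ⟨K, hK⟩ := (hD.eventually (gt_mem_nhds (by simp : (0 : ℝ≥0∞) < 1))).exists
    have h3 := hJI K
    rw [hI0, zero_add] at h3
    have h4 := ENNReal.mul_lt_mul_left (hJpos K) (hJtop K) hK
    rw [one_mul] at h4
    exact absurd h3 (not_le.2 h4)

end Asymptotics

/-! ### From the limit to the equivalence; laws of the walk -/

section Equivalence

variable {d : ℕ}

lemma gaussDensity_pos {S : Matrix (Fin d) (Fin d) ℝ} (hS : S.PosDef) (a : E d) :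
    0 < gaussDensity S a := by
  have := hS.det_pos
  have := Real.pi_pos
  unfold gaussDensity
  positivity

variable (μ : PMF ℕ) (hμ : IsCritical μ) (P : Measure (E d))
  {A : Set (E d)}

lemma hit_eq_measure (hA : MeasurableSet A) (n : ℕ) (x : E d) :
    hit μ P A n x = bpLaw μ P {T | 1 ≤ count T n (translate A x)} := by
  have hset : {T : MarkedTree d | 1 ≤ count T n (translate A x)} = {T | cnt A n T x ≠ 0} := by
    ext T
    simp only [count_translate, Set.mem_ofPred_eq, Nat.one_le_cast]
    omega
  have hm : MeasurableSet {T : MarkedTree d | cnt A n T x ≠ 0} :=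
    (measurable_cnt_left hA n x) (MeasurableSet.of_discrete (s := {m : ℕ | m ≠ 0}))
  rw [hset, ← lintegral_indicator_one hm]
  refine lintegral_congr fun T => ?_
  by_cases h : cnt A n T x = 0 <;> simp [h]

variable [IsProbabilityMeasure P]

include hμ in
-- Division by the limit requires I to be nonzero and finite, since `toReal` sends ∞ to 0.
lemma LocalLimit.isEquivalent {P : Measure (E d)} [IsProbabilityMeasure P] {lam : Measure (E d)}
    [SFinite lam] {L : Set (E d)} {h : ℕ → E d → ℝ≥0∞} {C : ℝ≥0∞} {an : ℕ → E d}
    {S : Matrix (Fin d) (Fin d) ℝ} {a : E d}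
    (H : LocalLimit P lam L h C an (ENNReal.ofReal (gaussDensity S a))) (hS : S.PosDef)
    (hd : 3 ≤ d) (h2 : HasSecondMoment μ) (hA : MeasurableSet A) (hfin : lam A ≠ ∞)
    (hpos : lam A ≠ 0) :
    (fun n : ℕ => (bpLaw μ P).real {T | 1 ≤ count T n (translate A (an n))}) ~[atTop]
      fun n : ℕ => (∫⁻ y in A, G μ hμ P A y ∂lam).toReal * gaussDensity S a *
        (n : ℝ) ^ (-(d : ℝ) / 2) := by
  obtain ⟨ht, hI0, hI⟩ := H.tendsto_hit μ hμ hd h2 hA hfin hpos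
  set I := ∫⁻ y in A, G μ hμ P A y ∂lam
  have hg := gaussDensity_pos hS a
  have hIpos : 0 < I.toReal := ENNReal.toReal_pos hI0 hI
  have hc : I.toReal * gaussDensity S a ≠ 0 := by positivity
  have hn : ∀ᶠ n : ℕ in atTop, I.toReal * gaussDensity S a * (n : ℝ) ^ (-(d : ℝ) / 2) ≠ 0 := by
    filter_upwards [eventually_gt_atTop 0] with n hn
    have : (0 : ℝ) < n := by exact_mod_cast hn
    positivity
  rw [isEquivalent_iff_tendsto_one hn]
  have h1 := ((ENNReal.tendsto_toReal (ENNReal.mul_ne_top ENNReal.ofReal_ne_top hI)).comp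
    ht).div_const (I.toReal * gaussDensity S a)
  rw [ENNReal.toReal_mul, ENNReal.toReal_ofReal hg.le, mul_comm (gaussDensity S a),
    div_self hc] at h1
  refine h1.congr' ?_
  filter_upwards [eventually_gt_atTop 0] with n hn
  have h0 : (0 : ℝ) < n := by exact_mod_cast hn
  have h3 : (n : ℝ) ^ (-(d : ℝ) / 2) = ((n : ℝ) ^ ((d : ℝ) / 2))⁻¹ := by
    rw [neg_div, Real.rpow_neg h0.le]
  have h4 : (0 : ℝ) < (n : ℝ) ^ ((d : ℝ) / 2) := by positivity
  simp only [Function.comp_apply, Pi.div_apply, ENNReal.toReal_mul]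
  rw [ENNReal.toReal_ofReal h4.le, hit_eq_measure μ P hA, h3, Measure.real]
  field_simp

instance (n : ℕ) : IsProbabilityMeasure (walkLaw P n) := by
  induction n with
  | zero => unfold walkLaw; infer_instance
  | succ n ih => unfold walkLaw; infer_instance

lemma iterate_transfer {f : E d → ℝ≥0∞} (hf : Measurable f) (m : ℕ) (x : E d) :
    (transfer P)^[m] f x = ∫⁻ y, f (x + y) ∂(walkLaw P m) := by
  induction m generalizing f x with
  | zero =>
    simp only [walkLaw, Function.iterate_zero, id]
    rw [lintegral_dirac' _ (by fun_prop), add_zero]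
  | succ m ih =>
    rw [Function.iterate_succ_apply, ih (measurable_transfer P hf), walkLaw,
      Measure.lintegral_conv (by fun_prop)]
    simp_rw [transfer, add_assoc]

lemma charFun_walkLaw (m : ℕ) (t : E d) : charFun (walkLaw P m) t = charFun P t ^ m := by
  induction m with
  | zero => simp [walkLaw]
  | succ m ih => rw [walkLaw, charFun_conv, ih, pow_succ]

lemma tendsto_inv_sqrt_smul_sub (K : ℕ) (y : E d) {an : ℕ → E d} {a : E d}
    (h : Tendsto (fun n : ℕ => (Real.sqrt n)⁻¹ • an n) atTop (𝓝 a)) :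
    Tendsto (fun m : ℕ => (Real.sqrt m)⁻¹ • (y - an (K + m))) atTop (𝓝 (-a)) := by
  have h0 : Tendsto (fun m : ℕ => (Real.sqrt m)⁻¹) atTop (𝓝 0) :=
    tendsto_inv_atTop_zero.comp (Real.tendsto_sqrt_atTop.comp tendsto_natCast_atTop_atTop)
  have h1 := tendsto_rpow_ratio (1 / 2) K
  simp_rw [← Real.sqrt_eq_rpow] at h1
  have h2 : Tendsto (fun m : ℕ => (Real.sqrt (K + m : ℕ))⁻¹ • an (K + m)) atTop (𝓝 a) := by
    have := (tendsto_add_atTop_iff_nat K).2 h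
    simpa only [add_comm K] using this
  have h3 := (h0.smul_const y).sub (h1.smul h2)
  rw [zero_smul, one_smul, zero_sub] at h3
  refine h3.congr' ?_
  filter_upwards [eventually_gt_atTop 0] with m hm
  have : (0 : ℝ) < (K + m : ℕ) := by exact_mod_cast (by omega)
  rw [smul_sub, smul_smul]
  congr 2
  field_simp

end Equivalence

/-! ### The Gaussian case -/

section Gaussian

variable {d : ℕ}

/-- The density of the Gaussian random walk at time `m`. -/
def gaussKernel (m : ℕ) (z : E d) : ℝ :=
  (2 * Real.pi * m) ^ (-(d : ℝ) / 2) * Real.exp (-‖z‖ ^ 2 / (2 * m))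

lemma gaussKernel_nonneg (m : ℕ) (z : E d) : 0 ≤ gaussKernel m z := by
  unfold gaussKernel
  positivity

lemma measurable_gaussKernel (m : ℕ) : Measurable (gaussKernel (d := d) m) := by
  unfold gaussKernel
  fun_prop

lemma integral_gaussKernel_mul_cexp {m : ℕ} (hm : 1 ≤ m) (t : E d) :
    ∫ z : E d, (gaussKernel m z : ℂ) * Complex.exp (inner ℝ z t * Complex.I) =
      Complex.exp (-‖t‖ ^ 2 / 2) ^ m := by
  have hm0 : (0 : ℝ) < m := by exact_mod_cast hm
  have hmC : (m : ℂ) ≠ 0 := by exact_mod_cast hm0.ne'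
  have hb : 0 < (((1 / (2 * m) : ℝ)) : ℂ).re := by
    rw [Complex.ofReal_re]
    positivity
  have hpi : 0 < 2 * Real.pi * m := by positivity
  have h1 : ∀ z : E d, (gaussKernel m z : ℂ) * Complex.exp (inner ℝ z t * Complex.I) =
      (((2 * Real.pi * m) ^ (-(d : ℝ) / 2) : ℝ) : ℂ) *
        Complex.exp (-((1 / (2 * m) : ℝ) : ℂ) * ‖z‖ ^ 2 + Complex.I * inner ℝ t z) := by
    intro z
    rw [Complex.exp_add, gaussKernel, real_inner_comm, mul_comm Complex.I]
    push_cast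
    rw [mul_assoc]
    congr 3
    field_simp
  simp_rw [h1]
  rw [integral_const_mul, GaussianFourier.integral_cexp_neg_mul_sq_norm_add hb,
    finrank_euclideanSpace_fin]
  have h2 : (Real.pi : ℂ) / ((1 / (2 * m) : ℝ) : ℂ) = ((2 * Real.pi * m : ℝ) : ℂ) := by
    push_cast
    field_simp
  have h3 : ((d : ℂ) / 2) = (((d : ℝ) / 2 : ℝ) : ℂ) := by push_cast; rfl
  rw [h2, h3, ← Complex.ofReal_cpow hpi.le, ← mul_assoc, ← Complex.ofReal_mul,
    ← Real.rpow_add hpi, ← Complex.exp_nat_mul]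
  have h4 : -(d : ℝ) / 2 + (d : ℝ) / 2 = 0 := by ring
  rw [h4, Real.rpow_zero, Complex.ofReal_one, one_mul, Complex.I_sq]
  congr 1
  push_cast
  field_simp
  norm_num

lemma integrable_gaussKernel {m : ℕ} (hm : 1 ≤ m) : Integrable (gaussKernel (d := d) m) := by
  have hm0 : (0 : ℝ) < m := by exact_mod_cast hm
  have hb : 0 < 1 / (2 * (m : ℝ)) := by positivity
  have h := GaussianFourier.integral_rexp_neg_mul_sq_norm (V := E d) hb
  have hi : Integrable fun v : E d => Real.exp (-(1 / (2 * (m : ℝ))) * ‖v‖ ^ 2) := by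
    -- A non-integrable function has Bochner integral 0 by convention, whereas the Gaussian integral
    -- is positive.
    by_contra hn
    rw [integral_undef hn] at h
    exact absurd h (by positivity)
  refine (hi.const_mul ((2 * Real.pi * m) ^ (-(d : ℝ) / 2))).congr (ae_of_all _ fun z => ?_)
  simp only [gaussKernel]
  congr 2
  field_simp

lemma rpow_mul_gaussKernel {m : ℕ} (hm : 1 ≤ m) (z : E d) :
    (m : ℝ) ^ ((d : ℝ) / 2) * gaussKernel m z =
      (2 * Real.pi) ^ (-(d : ℝ) / 2) * Real.exp (-‖(Real.sqrt m)⁻¹ • z‖ ^ 2 / 2) := by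
  have hm0 : (0 : ℝ) < m := by exact_mod_cast hm
  rw [gaussKernel, Real.mul_rpow (by positivity) hm0.le, ← mul_assoc, mul_left_comm, mul_assoc,
    neg_div, Real.rpow_neg hm0.le, norm_smul, mul_pow, norm_inv, Real.norm_of_nonneg
    (Real.sqrt_nonneg _), inv_pow, Real.sq_sqrt hm0.le, mul_inv_cancel₀ (by positivity), one_mul]
  congr 2
  field_simp

/-- Two finite measures with the same characteristic function coincide. Time 0 is excluded, the law
being a Dirac mass. -/
lemma walkLaw_stdGaussian {m : ℕ} (hm : 1 ≤ m) :
    walkLaw (stdGaussian (E d)) m =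
      (volume : Measure (E d)).withDensity fun z => ENNReal.ofReal (gaussKernel m z) := by
  have : IsFiniteMeasure ((volume : Measure (E d)).withDensity
      fun z => ENNReal.ofReal (gaussKernel m z)) :=
    isFiniteMeasure_withDensity_ofReal (integrable_gaussKernel hm).2
  refine Measure.ext_of_charFun ?_
  ext t
  rw [charFun_walkLaw, charFun_stdGaussian, charFun_apply, integral_withDensity_eq_integral_toReal_smul
    (measurable_gaussKernel m).ennreal_ofReal (by simp), ← integral_gaussKernel_mul_cexp hm]
  refine integral_congr_ae (ae_of_all _ fun z => ?_)
  simp [gaussKernel_nonneg]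

lemma localLimit_stdGaussian (a : E d) :
    LocalLimit (stdGaussian (E d)) volume Set.univ
      (fun m z => ENNReal.ofReal (gaussKernel m z))
      (ENNReal.ofReal ((2 * Real.pi) ^ (-(d : ℝ) / 2))) (fun n : ℕ => Real.sqrt n • a)
      (ENNReal.ofReal (gaussDensity 1 a)) where
  step_mem := by simp
  ae_mem := by simp
  an_mem := by simp
  invariant := ae_of_all _ fun ρ F hF => lintegral_add_right_eq_self F ρ
  measurable m := (measurable_gaussKernel m).ennreal_ofReal
  density m hm f hf x _ := by
    rw [iterate_transfer _ hf, walkLaw_stdGaussian hm, lintegral_withDensity_eq_lintegral_mul _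
      (measurable_gaussKernel m).ennreal_ofReal (by fun_prop),
      ← lintegral_sub_right_eq_self _ x]
    simp
  bound_ne_top := ENNReal.ofReal_ne_top
  bound m z := by
    rw [← ENNReal.ofReal_mul (by positivity)]
    refine ENNReal.ofReal_le_ofReal ?_
    -- The bound is also required at m = 0, where the power of m vanishes except in dimension 0.
    rcases Nat.eq_zero_or_pos m with rfl | hm
    · rcases Nat.eq_zero_or_pos d with rfl | hd
      · simp [gaussKernel]
      · have : (0 : ℝ) < d := by exact_mod_cast hd
        rw [Nat.cast_zero, Real.zero_rpow (by positivity), zero_mul]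
        positivity
    · rw [rpow_mul_gaussKernel hm]
      refine mul_le_of_le_one_right (by positivity) (Real.exp_le_one_iff.2 ?_)
      have := sq_nonneg ‖(Real.sqrt m)⁻¹ • z‖
      linarith
  limit K := ae_of_all _ fun y => by
    have h1 : Tendsto (fun m : ℕ => (Real.sqrt m)⁻¹ • (y - Real.sqrt (K + m : ℕ) • a)) atTop
        (𝓝 (-a)) := tendsto_inv_sqrt_smul_sub K y (an := fun n : ℕ => Real.sqrt n • a) <| by
      refine tendsto_const_nhds.congr' ?_
      filter_upwards [eventually_gt_atTop 0] with n hn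
      rw [smul_smul, inv_mul_cancel₀ (by positivity), one_smul]
    have h2 := ENNReal.tendsto_ofReal ((((h1.norm.pow 2).neg.div_const 2).rexp).const_mul
      ((2 * Real.pi) ^ (-(d : ℝ) / 2)))
    have h3 : gaussDensity 1 a = (2 * Real.pi) ^ (-(d : ℝ) / 2) * Real.exp (-‖-a‖ ^ 2 / 2) := by
      simp [gaussDensity]
    rw [h3]
    refine h2.congr' ?_
    filter_upwards [eventually_gt_atTop 0] with m hm
    rw [← ENNReal.ofReal_mul (by positivity), rpow_mul_gaussKernel hm]
  limit_ne_top := ENNReal.ofReal_ne_top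

end Gaussian

/-! ### The characteristic function of a symmetric lattice walk -/

section LatticeStep

set_option linter.unusedSectionVars false

variable {d : ℕ}

/-- A symmetric motion law with finite range in the lattice. -/
structure IsLatticeStep (P : Measure (E d)) (R : Finset (E d)) (p : E d → ℝ≥0∞) : Prop where
  subset : (R : Set (E d)) ⊆ intLattice d
  eq_sum : P = ∑ x ∈ R, p x • Measure.dirac x
  symm : ∀ x ∈ R, -x ∈ R ∧ p (-x) = p x

/-- The real characteristic function of a symmetric law. -/
def cosFun (P : Measure (E d)) (θ : E d) : ℝ := ∫ x, Real.cos (inner ℝ x θ) ∂P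

/-- The variance of the steps in direction `t`. -/
def stepVar (P : Measure (E d)) (t : E d) : ℝ := ∫ x, inner ℝ x t ^ 2 ∂P

/-- The cube `[-π, π]^d`. -/
def cube (d : ℕ) : Set (E d) := {θ | ∀ i, |θ i| ≤ Real.pi}

lemma isClosed_cube : IsClosed (cube d) := by
  simp only [cube, Set.ofPred_forall]
  exact isClosed_iInter fun i => isClosed_le (by fun_prop) continuous_const

lemma norm_sq_le_of_mem_cube {θ : E d} (h : θ ∈ cube d) : ‖θ‖ ^ 2 ≤ d * Real.pi ^ 2 := by
  rw [EuclideanSpace.real_norm_sq_eq]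
  refine (Finset.sum_le_sum (g := fun _ => Real.pi ^ 2) fun i _ => ?_).trans (by simp)
  rw [← sq_abs]
  exact pow_le_pow_left₀ (abs_nonneg _) (h i) 2

lemma isCompact_cube : IsCompact (cube d) := by
  refine Metric.isCompact_of_isClosed_isBounded isClosed_cube ?_
  refine (Metric.isBounded_closedBall (x := (0 : E d)) (r := Real.sqrt (d * Real.pi ^ 2))).subset
    fun θ hθ => ?_
  rw [mem_closedBall_zero_iff]
  exact Real.le_sqrt_of_sq_le (norm_sq_le_of_mem_cube hθ)

lemma mem_cube_of_norm_le {θ : E d} (h : ‖θ‖ ≤ 1) : θ ∈ cube d := fun i => by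
  have h1 : ‖θ i‖ ≤ ‖θ‖ := PiLp.norm_apply_le θ i
  rw [Real.norm_eq_abs] at h1
  linarith [Real.pi_gt_three]

lemma neg_mem_intLattice {x : E d} (h : x ∈ intLattice d) : -x ∈ intLattice d := fun i => by
  obtain ⟨z, hz⟩ := h i
  exact ⟨-z, by simp [hz]⟩

lemma add_mem_intLattice {x y : E d} (hx : x ∈ intLattice d) (hy : y ∈ intLattice d) :
    x + y ∈ intLattice d := fun i => by
  obtain ⟨z, hz⟩ := hx i
  obtain ⟨w, hw⟩ := hy i
  exact ⟨z + w, by simp [hz, hw]⟩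

variable {P : Measure (E d)} [IsProbabilityMeasure P] {R : Finset (E d)} {p : E d → ℝ≥0∞}

lemma IsLatticeStep.weight_ne_top (H : IsLatticeStep P R p) {x : E d} (hx : x ∈ R) :
    p x ≠ ∞ := by
  have h : p x ≤ P Set.univ := by
    rw [H.eq_sum, Measure.finsetSum_apply]
    simpa using Finset.single_le_sum (f := p) (fun _ _ => zero_le) hx
  rw [measure_univ] at h
  exact ne_top_of_le_ne_top ENNReal.one_ne_top h

lemma IsLatticeStep.integrable (H : IsLatticeStep P R p) {F : Type*} [NormedAddCommGroup F]
    (f : E d → F) : Integrable f P := by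
  rw [H.eq_sum, integrable_finsetSum_measure]
  exact fun x hx => (integrable_dirac (by simp)).smul_measure (H.weight_ne_top hx)

lemma IsLatticeStep.integral_eq (H : IsLatticeStep P R p) {F : Type*} [NormedAddCommGroup F]
    [NormedSpace ℝ F] [CompleteSpace F] (f : E d → F) :
    ∫ x, f x ∂P = ∑ x ∈ R, (p x).toReal • f x := by
  conv_lhs => rw [H.eq_sum]
  rw [integral_finsetSum_measure]
  · simp
  · exact fun x hx => (integrable_dirac (by simp)).smul_measure (H.weight_ne_top hx)

lemma IsLatticeStep.ae_mem (H : IsLatticeStep P R p) : ∀ᵐ x ∂P, x ∈ R := by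
  rw [ae_iff]
  conv_lhs => rw [H.eq_sum]
  rw [Measure.finsetSum_apply]
  refine Finset.sum_eq_zero fun x hx => ?_
  simp [hx]

lemma IsLatticeStep.ae_intLattice (H : IsLatticeStep P R p) : ∀ᵐ x ∂P, x ∈ intLattice d := by
  filter_upwards [H.ae_mem] with x hx using H.subset hx

lemma IsLatticeStep.integral_odd (H : IsLatticeStep P R p) {f : E d → ℝ}
    (hf : ∀ x, f (-x) = -f x) : ∫ x, f x ∂P = 0 := by
  rw [H.integral_eq]
  have h : ∑ x ∈ R, (p x).toReal • f x = ∑ x ∈ R, (p (-x)).toReal • f (-x) :=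
    Finset.sum_nbij' (fun x => -x) (fun x => -x) (fun x hx => (H.symm x hx).1)
      (fun x hx => (H.symm x hx).1) (fun x _ => neg_neg x) (fun x _ => neg_neg x)
      (fun x _ => by simp)
  have h2 : ∑ x ∈ R, (p (-x)).toReal • f (-x) = -∑ x ∈ R, (p x).toReal • f x := by
    rw [← Finset.sum_neg_distrib]
    refine Finset.sum_congr rfl fun x hx => ?_
    rw [hf, (H.symm x hx).2, smul_neg]
  linarith

lemma IsLatticeStep.charFun_eq (H : IsLatticeStep P R p) (θ : E d) :
    charFun P θ = cosFun P θ := by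
  have h1 : ∀ x : E d, Complex.exp (inner ℝ x θ * Complex.I) =
      ((Real.cos (inner ℝ x θ) : ℝ) : ℂ) + ((Real.sin (inner ℝ x θ) : ℝ) : ℂ) * Complex.I := by
    intro x
    rw [Complex.exp_mul_I]
    simp
  rw [charFun_apply]
  simp_rw [h1]
  rw [integral_add (H.integrable _) (H.integrable _), integral_mul_const,
    integral_complex_ofReal, integral_complex_ofReal,
    H.integral_odd (f := fun x => Real.sin (inner ℝ x θ)) (fun x => by simp)]
  simp [cosFun]

lemma IsLatticeStep.continuous_cosFun (H : IsLatticeStep P R p) : Continuous (cosFun P) := by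
  unfold cosFun
  simp_rw [H.integral_eq]
  fun_prop

lemma IsLatticeStep.continuous_stepVar (H : IsLatticeStep P R p) : Continuous (stepVar P) := by
  unfold stepVar
  simp_rw [H.integral_eq]
  fun_prop

/-- Symmetry makes the steps centred, so second moments are covariances. -/
lemma IsLatticeStep.stepVar_eq (H : IsLatticeStep P R p) (t : E d) :
    stepVar P t = inner ℝ t (Matrix.toEuclideanLin (covMatrix P) t) := by
  have hmean : ∀ i, ∫ x : E d, x i ∂P = 0 := fun i => H.integral_odd fun x => by simp
  have hcov : ∀ i j, covMatrix P i j = ∑ x ∈ R, (p x).toReal * (x i * x j) := by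
    intro i j
    simp only [covMatrix, Matrix.of_apply, covariance, hmean, sub_zero]
    rw [H.integral_eq]
    rfl
  have hin : ∀ x : E d, inner ℝ x t = ∑ i, x i * t i := fun x => by
    simp [PiLp.inner_apply, mul_comm]
  rw [stepVar, H.integral_eq]
  simp only [PiLp.inner_apply, Matrix.toLpLin_apply, Matrix.mulVec, dotProduct, hcov,
    RCLike.inner_apply, conj_trivial, smul_eq_mul]
  simp_rw [pow_two, Finset.sum_mul, Finset.mul_sum]
  rw [Finset.sum_comm]
  refine Finset.sum_congr rfl fun i _ => ?_
  rw [Finset.sum_comm]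
  refine Finset.sum_congr rfl fun j _ => ?_
  refine Finset.sum_congr rfl fun x _ => ?_
  ring

lemma IsLatticeStep.exists_stepVar_ge (H : IsLatticeStep P R p) (hS : (covMatrix P).PosDef) :
    ∃ c > 0, ∀ t : E d, c * ‖t‖ ^ 2 ≤ stepVar P t := by
  have hpos : ∀ t : E d, t ≠ 0 → 0 < stepVar P t := by
    intro t ht
    rw [H.stepVar_eq]
    have := hS.dotProduct_mulVec_pos (x := t.ofLp) (by simpa using ht)
    simpa [PiLp.inner_apply, Matrix.toLpLin_apply, dotProduct, mul_comm] using this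
  obtain ⟨c, hc, hle⟩ := (isCompact_sphere (0 : E d) 1).exists_forall_le'
    H.continuous_stepVar.continuousOn (a := 0)
    fun t ht => hpos t (by rintro rfl; simp at ht)
  refine ⟨c, hc, fun t => ?_⟩
  rcases eq_or_ne t 0 with rfl | ht
  · simp [stepVar]
  · have h1 := hle (‖t‖⁻¹ • t) (by simp [norm_smul, ht])
    have h2 : stepVar P (‖t‖⁻¹ • t) = (‖t‖ ^ 2)⁻¹ * stepVar P t := by
      simp only [stepVar, inner_smul_right, mul_pow, inv_pow]
      rw [integral_const_mul]
    rw [h2] at h1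
    have h3 : 0 < ‖t‖ ^ 2 := by positivity
    calc c * ‖t‖ ^ 2 ≤ (‖t‖ ^ 2)⁻¹ * stepVar P t * ‖t‖ ^ 2 := by gcongr
      _ = stepVar P t := by field_simp

lemma IsLatticeStep.cosFun_near_zero (H : IsLatticeStep P R p) (hS : (covMatrix P).PosDef) :
    ∃ c > 0, ∃ δ > 0, ∀ θ : E d, ‖θ‖ ≤ δ → |cosFun P θ| ≤ Real.exp (-(c * ‖θ‖ ^ 2)) := by
  obtain ⟨c, hc, hvar⟩ := H.exists_stepVar_ge hS
  -- The radius forces |⟨x, θ⟩| ≤ 1 for every step x, so that cosines are nonnegative and cos s ≤ 1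
  -- - (2/π²) s² applies; c bounds the variance below.
  refine ⟨2 / Real.pi ^ 2 * c, by positivity, (1 + ∑ x ∈ R, ‖x‖)⁻¹, by positivity, fun θ hθ => ?_⟩
  have hin : ∀ᵐ x ∂P, |inner ℝ x θ| ≤ 1 := by
    filter_upwards [H.ae_mem] with x hx
    have h1 : ‖x‖ ≤ ∑ x ∈ R, ‖x‖ := Finset.single_le_sum (f := fun x : E d => ‖x‖) (fun _ _ => norm_nonneg _) hx
    calc |inner ℝ x θ| ≤ ‖x‖ * ‖θ‖ := abs_real_inner_le_norm x θ
      _ ≤ (1 + ∑ x ∈ R, ‖x‖) * (1 + ∑ x ∈ R, ‖x‖)⁻¹ := by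
        gcongr
        linarith
      _ = 1 := mul_inv_cancel₀ (by positivity)
  have h0 : 0 ≤ cosFun P θ := integral_nonneg_of_ae <| by
    filter_upwards [hin] with x hx
    rw [abs_le] at hx
    exact Real.cos_nonneg_of_mem_Icc ⟨by linarith [Real.pi_gt_three], by linarith [Real.pi_gt_three]⟩
  rw [abs_of_nonneg h0]
  have h1 : cosFun P θ ≤ ∫ x, (1 - 2 / Real.pi ^ 2 * inner ℝ x θ ^ 2) ∂P := by
    refine integral_mono_ae (H.integrable _) (H.integrable _) ?_
    filter_upwards [hin] with x hx
    exact Real.cos_le_one_sub_mul_cos_sq (by linarith [Real.pi_gt_three])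
  rw [integral_sub (H.integrable _) (H.integrable _), integral_const_mul] at h1
  simp only [integral_const, probReal_univ, one_smul] at h1
  have h2 := Real.add_one_le_exp (-(2 / Real.pi ^ 2 * c * ‖θ‖ ^ 2))
  have h3 : 2 / Real.pi ^ 2 * (c * ‖θ‖ ^ 2) ≤ 2 / Real.pi ^ 2 * stepVar P θ := by
    gcongr
    exact hvar θ
  simp only [stepVar] at h3
  linarith

lemma integral_cos_le_one (Q : Measure (E d)) [IsProbabilityMeasure Q] (θ : E d) :
    |∫ x, Real.cos (inner ℝ x θ) ∂Q| ≤ 1 := by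
  have := norm_integral_le_of_norm_le_const (μ := Q) (f := fun x => Real.cos (inner ℝ x θ))
    (C := 1) (ae_of_all _ fun x => Real.abs_cos_le_one _)
  simpa using this

/-- If |φ(θ)| = 1, then cos⟨x, θ⟩ = 1 almost surely at even times. Aperiodicity charges each basis
vector at a large even time, so cos θ_j = 1, and |θ_j| ≤ π forces θ_j = 0. -/
lemma IsLatticeStep.abs_cosFun_lt_one (H : IsLatticeStep P R p) (hap : IsAperiodic P) {θ : E d}
    (hθ : θ ∈ cube d) (h0 : θ ≠ 0) : |cosFun P θ| < 1 := by
  refine lt_of_le_of_ne (integral_cos_le_one P θ) fun h1 => h0 ?_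
  have hbasis : ∀ j : Fin d, EuclideanSpace.single j (1 : ℝ) ∈ intLattice d := fun j i => by
    by_cases h : i = j
    · exact ⟨1, by simp [h]⟩
    · exact ⟨0, by simp [h]⟩
  ext j
  obtain ⟨N, hN⟩ := eventually_atTop.1 (hap _ (hbasis j))
  -- An even time also handles the value -1 of the real characteristic function.
  have hpos := hN (2 * N) (by omega)
  set Q := walkLaw P (2 * N)
  have hcos : ∫ x, Real.cos (inner ℝ x θ) ∂Q = 1 := by
    have h2 : charFun Q θ = 1 := by
      rw [charFun_walkLaw, H.charFun_eq, pow_mul, ← Complex.ofReal_pow, ← sq_abs, h1]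
      simp
    have h3 := congrArg Complex.re h2
    rw [charFun_apply, ← RCLike.re_eq_complex_re, ← integral_re] at h3
    · simpa [Complex.exp_ofReal_mul_I_re] using h3
    · refine (integrable_const (1 : ℝ)).mono (by fun_prop) (ae_of_all _ fun x => ?_)
      simp [Complex.norm_exp_ofReal_mul_I]
  have hint : Integrable (fun x => Real.cos (inner ℝ x θ)) Q :=
    (integrable_const (1 : ℝ)).mono (by fun_prop)
      (ae_of_all _ fun x => by simpa using Real.abs_cos_le_one _)
  have hae : (fun x => 1 - Real.cos (inner ℝ x θ)) =ᵐ[Q] 0 := by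
    rw [← integral_eq_zero_iff_of_nonneg]
    · rw [integral_sub (integrable_const _) hint, hcos]
      simp
    · exact fun x => sub_nonneg.2 (Real.cos_le_one _)
    · exact (integrable_const _).sub hint
  have hj : Real.cos (θ j) = 1 := by
    by_contra hne
    have hsub : {EuclideanSpace.single j (1 : ℝ)} ⊆
        {x : E d | ¬ (1 - Real.cos (inner ℝ x θ) = (0 : E d → ℝ) x)} := by
      rintro _ rfl
      simp only [Set.mem_ofPred_eq, EuclideanSpace.inner_single_left, Pi.zero_apply]
      intro h
      apply hne
      simp at h
      linarith
    exact hpos.ne' (measure_mono_null hsub (ae_iff.1 hae))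
  have hb := abs_le.1 (hθ j)
  exact (Real.cos_eq_one_iff_of_lt_of_lt (by linarith [Real.pi_pos])
    (by linarith [Real.pi_pos])).1 hj

lemma IsLatticeStep.exists_cosFun_le (H : IsLatticeStep P R p) (hS : (covMatrix P).PosDef)
    (hap : IsAperiodic P) :
    ∃ c > 0, ∀ θ ∈ cube d, |cosFun P θ| ≤ Real.exp (-(c * ‖θ‖ ^ 2)) := by
  obtain ⟨c, hc, δ, hδ, hnear⟩ := H.cosFun_near_zero hS
  have hK : IsCompact (cube d ∩ {θ | δ ≤ ‖θ‖}) :=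
    isCompact_cube.inter_right (isClosed_le continuous_const continuous_norm)
  obtain ⟨ε, hε, hfar⟩ := hK.exists_forall_le' (f := fun θ => 1 - |cosFun P θ|) (a := 0)
    (continuous_const.sub H.continuous_cosFun.abs).continuousOn fun θ hθ =>
      sub_pos.2 (H.abs_cosFun_lt_one hap hθ.1 (by
        rintro rfl
        simp only [Set.mem_inter_iff, Set.mem_ofPred_eq, norm_zero] at hθ
        linarith [hθ.2]))
  -- Away from 0 the exponent is at most ε, because ‖θ‖² ≤ d π² on the cube, and |φ| ≤ 1 - ε; the 1
  -- keeps the denominator positive.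
  refine ⟨min c (ε / (d * Real.pi ^ 2 + 1)), by positivity, fun θ hθ => ?_⟩
  rcases le_total ‖θ‖ δ with h | h
  · refine (hnear θ h).trans (Real.exp_le_exp.2 (neg_le_neg ?_))
    gcongr
    exact min_le_left _ _
  · have h1 := hfar θ ⟨hθ, h⟩
    have h2 : min c (ε / (d * Real.pi ^ 2 + 1)) * ‖θ‖ ^ 2 ≤ ε := by
      calc min c (ε / (d * Real.pi ^ 2 + 1)) * ‖θ‖ ^ 2
          ≤ ε / (d * Real.pi ^ 2 + 1) * (d * Real.pi ^ 2 + 1) := by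
            gcongr
            · exact min_le_right _ _
            · linarith [norm_sq_le_of_mem_cube hθ]
        _ = ε := div_mul_cancel₀ _ (by positivity)
    have h3 := Real.add_one_le_exp (-(min c (ε / (d * Real.pi ^ 2 + 1)) * ‖θ‖ ^ 2))
    linarith

lemma IsLatticeStep.tendsto_cosFun_pow (H : IsLatticeStep P R p) (t : E d) :
    Tendsto (fun m : ℕ => cosFun P ((Real.sqrt m)⁻¹ • t) ^ m) atTop
      (𝓝 (Real.exp (-stepVar P t / 2))) := by
  have hlim : ∀ s : ℝ, Tendsto (fun m : ℕ => (m : ℝ) * (Real.cos ((Real.sqrt m)⁻¹ * s) - 1)) atTop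
      (𝓝 (-s ^ 2 / 2)) := by
    intro s
    rw [← tendsto_sub_nhds_zero_iff]
    -- The constant 5/96 is that of `Real.cos_bound`, valid for arguments at most 1 in modulus,
    -- hence the restriction to m ≥ s².
    have hz : Tendsto (fun m : ℕ => s ^ 4 * (5 / 96) / (m : ℝ)) atTop (𝓝 0) :=
      tendsto_const_div_atTop_nhds_zero_nat _
    refine squeeze_zero_norm' ?_ hz
    filter_upwards [eventually_gt_atTop 0, eventually_ge_atTop ⌈s ^ 2⌉₊] with m hm hm2
    have hm0 : (0 : ℝ) < m := by exact_mod_cast hm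
    have hsq : ((Real.sqrt m)⁻¹ * s) ^ 2 = s ^ 2 / m := by
      rw [mul_pow, inv_pow, Real.sq_sqrt hm0.le]
      field_simp
    have hle : |(Real.sqrt m)⁻¹ * s| ≤ 1 := by
      rw [← sq_le_one_iff_abs_le_one, hsq, div_le_one hm0]
      exact Nat.ceil_le.1 hm2
    have hb := Real.cos_bound hle
    have h4 : |(Real.sqrt m)⁻¹ * s| ^ 4 = s ^ 4 / m ^ 2 := by
      rw [show 4 = 2 * 2 by rfl, pow_mul, sq_abs, hsq]
      field_simp
    rw [hsq, h4] at hb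
    calc ‖(m : ℝ) * (Real.cos ((Real.sqrt m)⁻¹ * s) - 1) - -s ^ 2 / 2‖
        = m * |Real.cos ((Real.sqrt m)⁻¹ * s) - (1 - s ^ 2 / m / 2)| := by
          rw [← abs_of_pos hm0, ← abs_mul, abs_of_pos hm0, Real.norm_eq_abs]
          congr 1
          field_simp
          ring
      _ ≤ m * (s ^ 4 / m ^ 2 * (5 / 96)) := by gcongr
      _ = s ^ 4 * (5 / 96) / m := by field_simp
  have h : Tendsto (fun m : ℕ => (m : ℝ) * (cosFun P ((Real.sqrt m)⁻¹ • t) - 1)) atTop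
      (𝓝 (-stepVar P t / 2)) := by
    have h1 : ∀ m : ℕ, (m : ℝ) * (cosFun P ((Real.sqrt m)⁻¹ • t) - 1) =
        ∑ x ∈ R, (p x).toReal • ((m : ℝ) * (Real.cos ((Real.sqrt m)⁻¹ * inner ℝ x t) - 1)) := by
      intro m
      have h2 : cosFun P ((Real.sqrt m)⁻¹ • t) - 1 =
          ∫ x, (Real.cos ((Real.sqrt m)⁻¹ * inner ℝ x t) - 1) ∂P := by
        rw [integral_sub (H.integrable _) (H.integrable _)]
        simp [cosFun, inner_smul_right]
      rw [h2, ← integral_const_mul, H.integral_eq]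
    simp_rw [h1]
    have h3 : -stepVar P t / 2 = ∑ x ∈ R, (p x).toReal • (-inner ℝ x t ^ 2 / 2) := by
      rw [stepVar, ← integral_neg, ← integral_div, H.integral_eq]
    rw [h3]
    exact tendsto_finsetSum _ fun x _ => (hlim _).const_smul _
  have := Real.tendsto_one_add_pow_exp_of_tendsto h
  simpa using this

end LatticeStep

/-! ### The local limit theorem on the lattice -/

section LocalLimitTheorem

set_option linter.unusedSectionVars false

variable {d : ℕ}

lemma integral_Icc_cexp_int (k : ℤ) :
    ∫ t in Set.Icc (-Real.pi) Real.pi, Complex.exp ((k : ℝ) * t * Complex.I) =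
      if k = 0 then 2 * (Real.pi : ℂ) else 0 := by
  rw [integral_Icc_eq_integral_Ioc, ← intervalIntegral.integral_of_le (by linarith [Real.pi_pos])]
  split_ifs with h
  · subst h
    simp
    ring
  · have hk : (k : ℂ) * Complex.I ≠ 0 := by simp [h]
    have h1 : ∀ t : ℝ, Complex.exp ((k : ℝ) * t * Complex.I) =
        Complex.exp ((k : ℂ) * Complex.I * t) := fun t => by
      congr 1
      push_cast
      ring
    simp_rw [h1]
    rw [integral_exp_mul_complex hk, div_eq_zero_iff, sub_eq_zero]
    left
    rw [Complex.exp_eq_exp_iff_exists_int]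
    refine ⟨k, ?_⟩
    push_cast
    ring

lemma measurableSet_cube : MeasurableSet (cube d) := isClosed_cube.measurableSet

lemma integral_cube_cexp {x : E d} (hx : x ∈ intLattice d) :
    ∫ θ in cube d, Complex.exp (inner ℝ x θ * Complex.I) =
      if x = 0 then (2 * (Real.pi : ℂ)) ^ d else 0 := by
  choose k hk using hx
  rw [← (PiLp.volume_preserving_toLp (Fin d)).setIntegral_preimage_emb
    (MeasurableEquiv.toLp 2 _).measurableEmbedding]
  have hpre : WithLp.toLp 2 ⁻¹' cube d = Set.univ.pi fun _ => Set.Icc (-Real.pi) Real.pi := by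
    ext y
    simp only [cube, Set.mem_preimage, Set.mem_ofPred_eq, Set.mem_univ_pi, Set.mem_Icc, abs_le]
  have hexp : ∀ y : Fin d → ℝ, Complex.exp (inner ℝ x (WithLp.toLp 2 y) * Complex.I) =
      ∏ i, Complex.exp ((k i : ℝ) * y i * Complex.I) := by
    intro y
    rw [← Complex.exp_sum, ← Finset.sum_mul]
    congr 2
    simp [PiLp.inner_apply, hk, mul_comm]
  simp_rw [hexp]
  rw [hpre, volume_pi, Measure.restrict_pi_pi, integral_fintype_prod_eq_prod
    (f := fun i (t : ℝ) => Complex.exp ((k i : ℝ) * t * Complex.I))]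
  simp_rw [integral_Icc_cexp_int]
  split_ifs with h
  · have : ∀ i, k i = 0 := fun i => by
      have := hk i
      rw [h] at this
      simpa using this.symm
    simp [this]
  · have : ∃ i, k i ≠ 0 := by
      by_contra! hc
      exact h (by ext i; simp [hk, hc])
    obtain ⟨i, hi⟩ := this
    exact Finset.prod_eq_zero (Finset.mem_univ i) (by simp [hi])

/-- Fourier inversion on the lattice: after Fubini, orthogonality of characters keeps only x = z. -/
lemma integral_cube_charFun (Q : Measure (E d)) [IsProbabilityMeasure Q]
    (hQ : ∀ᵐ x ∂Q, x ∈ intLattice d) {z : E d} (hz : z ∈ intLattice d) :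
    ∫ θ in cube d, charFun Q θ * Complex.exp (-(inner ℝ z θ * Complex.I)) =
      (2 * (Real.pi : ℂ)) ^ d * Q.real {z} := by
  have : IsFiniteMeasure (volume.restrict (cube d)) :=
    ⟨by simpa using isCompact_cube.measure_lt_top⟩
  have h1 : ∀ θ : E d, charFun Q θ * Complex.exp (-(inner ℝ z θ * Complex.I)) =
      ∫ x, Complex.exp (inner ℝ (x - z) θ * Complex.I) ∂Q := by
    intro θ
    rw [charFun_apply, ← integral_mul_const]
    refine integral_congr_ae (ae_of_all _ fun x => ?_)
    dsimp only
    rw [← Complex.exp_add, inner_sub_left]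
    congr 1
    push_cast
    ring
  simp_rw [h1]
  rw [integral_integral_swap]
  · have h2 : ∀ᵐ x ∂Q, ∫ θ in cube d, Complex.exp (inner ℝ (x - z) θ * Complex.I) =
        Set.indicator {z} (fun _ => (2 * (Real.pi : ℂ)) ^ d) x := by
      filter_upwards [hQ] with x hx
      rw [sub_eq_add_neg, integral_cube_cexp (add_mem_intLattice hx (neg_mem_intLattice hz)),
        ← sub_eq_add_neg]
      simp [Set.indicator_apply, sub_eq_zero]
    rw [integral_congr_ae h2, integral_indicator (measurableSet_singleton z)]
    simp [mul_comm, Measure.real]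
  · refine (integrable_const (1 : ℝ)).mono (Measurable.aestronglyMeasurable (by fun_prop))
      (ae_of_all _ fun q => ?_)
    simp [Function.uncurry, Complex.norm_exp_ofReal_mul_I]

variable {P : Measure (E d)} [IsProbabilityMeasure P] {R : Finset (E d)} {p : E d → ℝ≥0∞}

lemma zero_mem_intLattice : (0 : E d) ∈ intLattice d := fun _ => ⟨0, by simp⟩

lemma IsLatticeStep.walkLaw_ae_mem (H : IsLatticeStep P R p) (m : ℕ) :
    ∀ᵐ x ∂(walkLaw P m), x ∈ intLattice d := by
  have hcount : MeasurableSet (intLattice d) := by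
    simp only [intLattice, Set.ofPred_forall, Set.ofPred_exists]
    exact MeasurableSet.iInter fun i => MeasurableSet.iUnion fun z =>
      measurableSet_eq_fun (by fun_prop) measurable_const
  induction m with
  | zero =>
    simp only [walkLaw]
    exact (ae_dirac_iff (p := (· ∈ intLattice d)) hcount).2 zero_mem_intLattice
  | succ m ih =>
    rw [walkLaw, Measure.conv]
    refine (ae_map_iff (p := (· ∈ intLattice d)) (by fun_prop) hcount).2 ?_
    have h1 : ∀ᵐ q ∂((walkLaw P m).prod P), q.1 ∈ intLattice d :=
      Measure.quasiMeasurePreserving_fst.ae ih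
    have h2 : ∀ᵐ q ∂((walkLaw P m).prod P), q.2 ∈ intLattice d :=
      Measure.quasiMeasurePreserving_snd.ae H.ae_intLattice
    filter_upwards [h1, h2] with q hq1 hq2 using add_mem_intLattice hq1 hq2

variable (P) in
/-- The rescaled integrand of the Fourier inversion formula. -/
def scaledIntegrand (m : ℕ) (z t : E d) : ℂ :=
  (cube d).indicator (fun θ => ((cosFun P θ ^ m : ℝ) : ℂ)) ((Real.sqrt m)⁻¹ • t) *
    Complex.exp (-(inner ℝ ((Real.sqrt m)⁻¹ • z) t * Complex.I))

lemma sqrt_pow_eq_rpow (m : ℕ) : Real.sqrt m ^ d = (m : ℝ) ^ ((d : ℝ) / 2) := by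
  rw [Real.sqrt_eq_rpow, ← Real.rpow_natCast, ← Real.rpow_mul (by positivity)]
  congr 1
  ring

lemma IsLatticeStep.integral_scaledIntegrand (H : IsLatticeStep P R p) (m : ℕ) {z : E d}
    (hz : z ∈ intLattice d) : ∫ t, scaledIntegrand P m z t =
      (((m : ℝ) ^ ((d : ℝ) / 2) * ((2 * Real.pi) ^ d * (walkLaw P m).real {z}) : ℝ) : ℂ) := by
  have h1 := Measure.integral_comp_smul (volume : Measure (E d)) ((cube d).indicator fun θ =>
    charFun (walkLaw P m) θ * Complex.exp (-(inner ℝ z θ * Complex.I))) (Real.sqrt m)⁻¹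
  rw [integral_indicator measurableSet_cube, integral_cube_charFun _ (H.walkLaw_ae_mem m) hz,
    finrank_euclideanSpace_fin, inv_pow, inv_inv, abs_of_nonneg (by positivity),
    sqrt_pow_eq_rpow] at h1
  rw [Complex.ofReal_mul, ← Complex.real_smul]
  push_cast
  rw [← h1]
  refine integral_congr_ae (ae_of_all _ fun t => ?_)
  by_cases ht : (Real.sqrt m)⁻¹ • t ∈ cube d
  · simp [scaledIntegrand, ht, charFun_walkLaw, H.charFun_eq, inner_smul_left, inner_smul_right]
  · simp [scaledIntegrand, ht]

lemma norm_scaledIntegrand_le {c : ℝ}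
    (hc : ∀ θ ∈ cube d, |cosFun P θ| ≤ Real.exp (-(c * ‖θ‖ ^ 2))) {m : ℕ} (hm : 1 ≤ m)
    (z t : E d) : ‖scaledIntegrand P m z t‖ ≤ Real.exp (-c * ‖t‖ ^ 2) := by
  have hm0 : (0 : ℝ) < m := by exact_mod_cast hm
  have h1 : ‖Complex.exp (-(inner ℝ ((Real.sqrt m)⁻¹ • z) t * Complex.I))‖ = 1 := by
    rw [← neg_mul, ← Complex.ofReal_neg, Complex.norm_exp_ofReal_mul_I]
  rw [scaledIntegrand, norm_mul, h1, mul_one]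
  by_cases ht : (Real.sqrt m)⁻¹ • t ∈ cube d
  · rw [Set.indicator_of_mem ht, Complex.norm_real, Real.norm_eq_abs, abs_pow]
    refine (pow_le_pow_left₀ (abs_nonneg _) (hc _ ht) m).trans_eq ?_
    rw [← Real.exp_nat_mul, norm_smul, mul_pow, norm_inv, Real.norm_of_nonneg (Real.sqrt_nonneg _),
      inv_pow, Real.sq_sqrt hm0.le]
    congr 1
    field_simp
  · rw [Set.indicator_of_notMem ht, norm_zero]
    positivity

lemma integrable_exp_neg_mul_norm_sq {c : ℝ} (hc : 0 < c) :
    Integrable fun t : E d => Real.exp (-c * ‖t‖ ^ 2) := by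
  have h := GaussianFourier.integral_rexp_neg_mul_sq_norm (V := E d) hc
  by_contra hn
  rw [integral_undef hn] at h
  exact absurd h (by positivity)

lemma IsLatticeStep.exists_walkLaw_le (H : IsLatticeStep P R p) (hS : (covMatrix P).PosDef)
    (hap : IsAperiodic P) :
    ∃ C : ℝ, ∀ m : ℕ, 1 ≤ m → ∀ z ∈ intLattice d,
      (m : ℝ) ^ ((d : ℝ) / 2) * (walkLaw P m).real {z} ≤ C := by
  obtain ⟨c, hc, hle⟩ := H.exists_cosFun_le hS hap
  refine ⟨(∫ t : E d, Real.exp (-c * ‖t‖ ^ 2)) / (2 * Real.pi) ^ d, fun m hm z hz => ?_⟩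
  rw [le_div_iff₀ (by positivity)]
  have h1 := norm_integral_le_of_norm_le (integrable_exp_neg_mul_norm_sq hc)
    (ae_of_all _ (norm_scaledIntegrand_le hle hm z))
  rw [H.integral_scaledIntegrand m hz, Complex.norm_real, Real.norm_of_nonneg (by positivity)] at h1
  linarith

open scoped MatrixOrder Matrix.Norms.L2Operator in
lemma exists_eq_conjTranspose_mul {S : Matrix (Fin d) (Fin d) ℝ} (hS : S.PosDef) :
    ∃ B : Matrix (Fin d) (Fin d) ℝ, S = B.conjTranspose * B :=
  CStarAlgebra.nonneg_iff_eq_star_mul_self.1 hS.posSemidef.nonneg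

lemma inner_toEuclideanLin (M : Matrix (Fin d) (Fin d) ℝ) (x y : E d) :
    inner ℝ x (Matrix.toEuclideanLin M y) =
      inner ℝ (Matrix.toEuclideanLin M.conjTranspose x) y := by
  rw [Matrix.toEuclideanLin_conjTranspose_eq_adjoint, LinearMap.adjoint_inner_left]

lemma toEuclideanLin_mul (M N : Matrix (Fin d) (Fin d) ℝ) (x : E d) :
    Matrix.toEuclideanLin (M * N) x = Matrix.toEuclideanLin M (Matrix.toEuclideanLin N x) := by
  simp [Matrix.toLpLin_apply, Matrix.mulVec_mulVec]

lemma integral_cexp_neg_norm_sq (w : E d) :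
    ∫ u : E d, Complex.exp (-(1 / 2) * ‖u‖ ^ 2 + -Complex.I * inner ℝ w u) =
      (((2 * Real.pi) ^ ((d : ℝ) / 2) * Real.exp (-‖w‖ ^ 2 / 2) : ℝ) : ℂ) := by
  rw [GaussianFourier.integral_cexp_neg_mul_sq_norm_add (by norm_num), finrank_euclideanSpace_fin]
  have h3 : ((d : ℂ) / 2) = (((d : ℝ) / 2 : ℝ) : ℂ) := by push_cast; rfl
  have h2 : (Real.pi : ℂ) / (1 / 2) = ((2 * Real.pi : ℝ) : ℂ) := by push_cast; ring
  rw [h2, h3, ← Complex.ofReal_cpow (by positivity), Complex.ofReal_mul]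
  congr 1
  rw [Complex.ofReal_exp, neg_sq, Complex.I_sq]
  congr 1
  push_cast
  ring

lemma integral_exp_neg_inner {S : Matrix (Fin d) (Fin d) ℝ} (hS : S.PosDef) (b : E d) :
    ∫ t : E d, ((Real.exp (-inner ℝ t (Matrix.toEuclideanLin S t) / 2) : ℝ) : ℂ) *
      Complex.exp (-(inner ℝ b t * Complex.I)) =
        (((2 * Real.pi) ^ d * gaussDensity S b : ℝ) : ℂ) := by
  obtain ⟨B, hB⟩ := exists_eq_conjTranspose_mul hS
  have hdet : S.det = B.det ^ 2 := by
    rw [hB, Matrix.det_mul, Matrix.det_conjTranspose, star_trivial, pow_two]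
  have hBdet : B.det ≠ 0 := by
    intro h
    have := hS.det_pos
    rw [hdet, h] at this
    simp at this
  have hunit : IsUnit B.det := hBdet.isUnit
  set f := Matrix.toEuclideanLin B
  have hfdet : LinearMap.det f = B.det := by
    simp only [f, Matrix.toLpLin_eq_toLin]
    exact LinearMap.det_toLin _ B
  -- In the variable u = B t, with S = Bᴴ B, the quadratic form becomes ‖u‖², ⟨b, t⟩ becomes ⟨w, u⟩,
  -- and ‖w‖² = ⟨b, S⁻¹ b⟩.
  set w := Matrix.toEuclideanLin B⁻¹.conjTranspose b with hw
  have hnorm : ∀ t : E d, inner ℝ t (Matrix.toEuclideanLin S t) = ‖f t‖ ^ 2 := by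
    intro t
    rw [hB, toEuclideanLin_mul, inner_toEuclideanLin, Matrix.conjTranspose_conjTranspose,
      real_inner_self_eq_norm_sq]
  have hwin : ∀ t : E d, inner ℝ b t = inner ℝ w (f t) := by
    intro t
    rw [hw, ← inner_toEuclideanLin, ← toEuclideanLin_mul, Matrix.nonsing_inv_mul _ hunit]
    simp
  have hwn : ‖w‖ ^ 2 = inner ℝ b (Matrix.toEuclideanLin S⁻¹ b) := by
    rw [← real_inner_self_eq_norm_sq, hw, ← inner_toEuclideanLin, ← toEuclideanLin_mul, hB,
      Matrix.mul_inv_rev, Matrix.conjTranspose_nonsing_inv]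
  have hcont : Continuous f := f.continuous_of_finiteDimensional
  have h1 : ∀ t : E d, ((Real.exp (-inner ℝ t (Matrix.toEuclideanLin S t) / 2) : ℝ) : ℂ) *
      Complex.exp (-(inner ℝ b t * Complex.I)) =
      Complex.exp (-(1 / 2) * ‖f t‖ ^ 2 + -Complex.I * inner ℝ w (f t)) := by
    intro t
    rw [hnorm, hwin, Complex.ofReal_exp, ← Complex.exp_add]
    congr 1
    push_cast
    ring
  simp_rw [h1]
  rw [← integral_map (f := fun u : E d => Complex.exp (-(1 / 2) * ‖u‖ ^ 2 +
    -Complex.I * inner ℝ w u)) hcont.aemeasurable (by fun_prop),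
    Measure.map_linearMap_addHaar_eq_smul_addHaar _ (by rwa [hfdet]), integral_smul_measure,
    integral_cexp_neg_norm_sq, hfdet, ENNReal.toReal_ofReal (abs_nonneg _), Complex.real_smul,
    ← Complex.ofReal_mul]
  congr 1
  have hpi : 0 < 2 * Real.pi := by positivity
  have hd : S.det ^ (-(1 : ℝ) / 2) = |B.det⁻¹| := by
    rw [hdet, ← sq_abs, ← Real.rpow_natCast, ← Real.rpow_mul (abs_nonneg _), abs_inv]
    norm_num
    rw [Real.rpow_neg_one]
  have hp : (2 * Real.pi) ^ d * (2 * Real.pi) ^ (-(d : ℝ) / 2) =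
      (2 * Real.pi) ^ ((d : ℝ) / 2) := by
    rw [← Real.rpow_natCast, ← Real.rpow_add hpi]
    congr 1
    ring
  rw [gaussDensity, hd, ← hwn, ← hp]
  ring

/-- Dominated convergence in the rescaled inversion formula. The Gaussian majorant comes from the
bound on the whole cube, and for fixed t the cutoff is eventually 1. -/
lemma IsLatticeStep.tendsto_walkLaw (H : IsLatticeStep P R p) (hS : (covMatrix P).PosDef)
    (hap : IsAperiodic P) {z : ℕ → E d} (hz : ∀ m, z m ∈ intLattice d) {b : E d}
    (hb : Tendsto (fun m : ℕ => (Real.sqrt m)⁻¹ • z m) atTop (𝓝 b)) :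
    Tendsto (fun m : ℕ => (m : ℝ) ^ ((d : ℝ) / 2) * (walkLaw P m).real {z m}) atTop
      (𝓝 (gaussDensity (covMatrix P) b)) := by
  obtain ⟨c, hc, hle⟩ := H.exists_cosFun_le hS hap
  have hcos := H.continuous_cosFun
  have h1 : Tendsto (fun m : ℕ => ∫ t, scaledIntegrand P m (z m) t) atTop
      (𝓝 (∫ t : E d, ((Real.exp (-stepVar P t / 2) : ℝ) : ℂ) *
        Complex.exp (-(inner ℝ b t * Complex.I)))) := by
    refine tendsto_integral_filter_of_dominated_convergence
      (fun t => Real.exp (-c * ‖t‖ ^ 2)) (Eventually.of_forall fun m => ?_) ?_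
      (integrable_exp_neg_mul_norm_sq hc) (ae_of_all _ fun t => ?_)
    · refine Measurable.aestronglyMeasurable (Measurable.mul ?_ (by fun_prop))
      have h2 : Measurable ((cube d).indicator (fun θ => ((cosFun P θ ^ m : ℝ) : ℂ))) :=
        Measurable.indicator (by fun_prop) measurableSet_cube
      exact h2.comp (by fun_prop)
    · filter_upwards [eventually_ge_atTop 1] with m hm
      exact ae_of_all _ (norm_scaledIntegrand_le hle hm (z m))
    · have h0 : Tendsto (fun m : ℕ => (Real.sqrt m)⁻¹ • t) atTop (𝓝 0) := by
        have := (tendsto_inv_atTop_zero.comp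
          (Real.tendsto_sqrt_atTop.comp tendsto_natCast_atTop_atTop)).smul_const t
        simpa using this
      have h3 : Tendsto (fun m : ℕ => Complex.exp (-(inner ℝ ((Real.sqrt m)⁻¹ • z m) t *
          Complex.I))) atTop (𝓝 (Complex.exp (-(inner ℝ b t * Complex.I)))) := by
        have h4 : Continuous fun y : E d => Complex.exp (-(inner ℝ y t * Complex.I)) := by fun_prop
        exact (h4.tendsto b).comp hb
      have h5 : Tendsto (fun m : ℕ => ((cosFun P ((Real.sqrt m)⁻¹ • t) ^ m : ℝ) : ℂ)) atTop
          (𝓝 ((Real.exp (-stepVar P t / 2) : ℝ) : ℂ)) :=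
        (Complex.continuous_ofReal.tendsto _).comp (H.tendsto_cosFun_pow t)
      refine (h5.mul h3).congr' ?_
      filter_upwards [h0.norm.eventually (ge_mem_nhds (by simp : ‖(0 : E d)‖ < 1))] with m hm
      rw [scaledIntegrand, Set.indicator_of_mem (mem_cube_of_norm_le hm)]
  simp_rw [fun m => H.integral_scaledIntegrand m (hz m), H.stepVar_eq] at h1
  rw [integral_exp_neg_inner hS] at h1
  have h2 := ((Complex.continuous_re.tendsto _).comp h1).div_const ((2 * Real.pi) ^ d)
  have hpi : (2 * Real.pi) ^ d ≠ 0 := by positivity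
  simp only [Function.comp_def, Complex.ofReal_re] at h2
  rw [mul_div_cancel_left₀ _ hpi] at h2
  refine h2.congr fun m => ?_
  field_simp

end LocalLimitTheorem

/-! ### The lattice case -/

section Lattice

variable {d : ℕ}

lemma countable_intLattice : (intLattice d).Countable := by
  refine (Set.countable_range fun k : Fin d → ℤ =>
    (WithLp.toLp 2 fun i => (k i : ℝ) : E d)).mono fun x hx => ?_
  choose k hk using hx
  exact ⟨k, by ext i; simp [hk]⟩

instance : Countable (intLattice d) := countable_intLattice.to_subtype

/-- The counting measure on the lattice. -/
def latticeMeasure (d : ℕ) : Measure (E d) :=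
  Measure.sum fun x : intLattice d => Measure.dirac (x : E d)

instance : SFinite (latticeMeasure d) := by
  unfold latticeMeasure
  infer_instance

lemma lintegral_latticeMeasure {F : E d → ℝ≥0∞} (hF : Measurable F) :
    ∫⁻ x, F x ∂(latticeMeasure d) = ∑' x : intLattice d, F x := by
  rw [latticeMeasure, lintegral_sum_measure]
  simp_rw [lintegral_dirac' _ hF]

lemma setLIntegral_latticeMeasure {A : Set (E d)} (hA : MeasurableSet A) {F : E d → ℝ≥0∞}
    (hF : Measurable F) :
    ∫⁻ x in A, F x ∂(latticeMeasure d) = ∑' x : (A ∩ intLattice d : Set (E d)), F x := by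
  rw [← lintegral_indicator hA, lintegral_latticeMeasure (hF.indicator hA),
    tsum_subtype (intLattice d) (A.indicator F), Set.indicator_indicator, Set.inter_comm,
    tsum_subtype (A ∩ intLattice d) F]

lemma latticeMeasure_apply {A : Set (E d)} (hA : MeasurableSet A) :
    latticeMeasure d A = (A ∩ intLattice d).encard := by
  have h := setLIntegral_latticeMeasure hA (F := fun _ => 1) measurable_const
  rw [setLIntegral_one] at h
  rw [h, ENNReal.tsum_set_one]

lemma measurableSet_intLattice : MeasurableSet (intLattice d) :=
  countable_intLattice.measurableSet

lemma finite_closedBall_inter_intLattice (c : E d) (r : ℝ) :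
    (Metric.closedBall c r ∩ intLattice d).Finite := by
  have hfin : (Set.univ.pi fun i : Fin d =>
      {k : ℤ | (k : ℝ) ∈ Set.Icc (c i - r) (c i + r)}).Finite := by
    refine Set.Finite.pi fun i => (Set.finite_Icc ⌈c i - r⌉ ⌊c i + r⌋).subset fun k hk => ?_
    exact ⟨Int.ceil_le.2 hk.1, Int.le_floor.2 hk.2⟩
  refine (hfin.image fun k => (WithLp.toLp 2 fun i => (k i : ℝ) : E d)).subset ?_
  rintro x ⟨hx, hL⟩
  choose k hk using hL
  refine ⟨k, fun i _ => ?_, by ext i; simp [hk]⟩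
  have h1 : ‖(x - c) i‖ ≤ ‖x - c‖ := PiLp.norm_apply_le (x - c) i
  rw [mem_closedBall_iff_norm] at hx
  have h2 := abs_le.1 (h1.trans hx)
  simp only [PiLp.sub_apply, hk] at h2
  exact ⟨by linarith [h2.1], by linarith [h2.2]⟩

/-- Translation of the lattice by one of its points. -/
def latticeShift {x : E d} (hx : x ∈ intLattice d) : intLattice d ≃ intLattice d where
  toFun y := ⟨y + x, add_mem_intLattice y.2 hx⟩
  invFun y := ⟨y + -x, add_mem_intLattice y.2 (neg_mem_intLattice hx)⟩
  left_inv y := by ext1; simp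
  right_inv y := by ext1; simp

variable {P : Measure (E d)} [IsProbabilityMeasure P] {R : Finset (E d)} {p : E d → ℝ≥0∞}

lemma gaussDensity_neg (S : Matrix (Fin d) (Fin d) ℝ) (a : E d) :
    gaussDensity S (-a) = gaussDensity S a := by
  simp [gaussDensity]

lemma IsLatticeStep.localLimit (H : IsLatticeStep P R p) (hd : 3 ≤ d)
    (hS : (covMatrix P).PosDef) (hap : IsAperiodic P) {an : ℕ → E d} {a : E d}
    (han : ∀ n, an n ∈ intLattice d)
    (ha : Tendsto (fun n : ℕ => (Real.sqrt n)⁻¹ • an n) atTop (𝓝 a)) :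
    ∃ C, LocalLimit P (latticeMeasure d) (intLattice d) (fun m z => walkLaw P m {z}) C an
      (ENNReal.ofReal (gaussDensity (covMatrix P) a)) := by
  obtain ⟨C, hC⟩ := H.exists_walkLaw_le hS hap
  have hlam : ∀ᵐ y ∂(latticeMeasure d), y ∈ intLattice d := by
    rw [ae_iff]
    change latticeMeasure d (intLattice d)ᶜ = 0
    rw [latticeMeasure_apply measurableSet_intLattice.compl]
    simp
  have hmeas : ∀ m, Measurable fun z : E d => walkLaw P m {z} := fun m => by
    -- The point mass at z is the measure of a section of the diagonal.
    have h := measurable_measure_prodMk_left (ν := walkLaw P m)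
      (s := {q : E d × E d | q.2 = q.1}) (measurableSet_eq_fun measurable_snd measurable_fst)
    exact h
  refine ⟨ENNReal.ofReal C, ?_, hlam, han, ?_, hmeas, ?_, ENNReal.ofReal_ne_top, ?_, ?_,
    ENNReal.ofReal_ne_top⟩
  · intro x hx
    filter_upwards [H.ae_intLattice] with ρ hρ using add_mem_intLattice hx hρ
  · filter_upwards [H.ae_intLattice] with ρ hρ F hF
    rw [lintegral_latticeMeasure hF, lintegral_latticeMeasure (by fun_prop)]
    exact (latticeShift hρ).tsum_eq (fun y => F y)
  · intro m _ f hf x hx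
    have hm : Measurable fun y => walkLaw P m {y - x} * f y :=
      ((hmeas m).comp (measurable_id.sub_const x)).mul hf
    -- The walk law is carried by the countable lattice, so the integral is a sum over point masses,
    -- matched to the other side by translation by x.
    rw [iterate_transfer _ hf, lintegral_latticeMeasure hm,
      ← Measure.restrict_eq_self_of_ae_mem (H.walkLaw_ae_mem m),
      lintegral_countable _ countable_intLattice,
      Measure.restrict_eq_self_of_ae_mem (H.walkLaw_ae_mem m),
      ← (latticeShift hx).tsum_eq fun y => walkLaw P m {(y : E d) - x} * f y]
    refine tsum_congr fun y => ?_
    simp [latticeShift, mul_comm, add_comm]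
  · intro m z
    by_cases hz : z ∈ intLattice d
    · rw [← ofReal_measureReal, ← ENNReal.ofReal_mul (by positivity)]
      rcases Nat.eq_zero_or_pos m with rfl | hm
      · have : (0 : ℝ) < d := by exact_mod_cast (by omega : 0 < d)
        rw [Nat.cast_zero, Real.zero_rpow (by positivity), zero_mul]
        simp
      · exact ENNReal.ofReal_le_ofReal (hC m hm z hz)
    · have h0 : walkLaw P m {z} = 0 :=
        measure_mono_null (Set.singleton_subset_iff.2 hz) (ae_iff.1 (H.walkLaw_ae_mem m))
      simp [h0]
  · intro K
    filter_upwards [hlam] with y hy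
    have h1 := H.tendsto_walkLaw hS hap (z := fun m => y - an (K + m)) (fun m => by
      rw [sub_eq_add_neg]
      exact add_mem_intLattice hy (neg_mem_intLattice (han _))) (tendsto_inv_sqrt_smul_sub K y ha)
    rw [gaussDensity_neg] at h1
    refine (ENNReal.tendsto_ofReal h1).congr fun m => ?_
    rw [ENNReal.ofReal_mul (by positivity), ofReal_measureReal]

lemma measurable_G (μ : PMF ℕ) (hμ : IsCritical μ) {A : Set (E d)} (hA : MeasurableSet A) :
    Measurable (G μ hμ P A) := by
  have h : G μ hμ P A = fun y => ⨅ K, truncG μ hμ P A K y := funext (G_eq_iInf μ hμ P hA)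
  rw [h]
  exact Measurable.iInf fun K => measurable_truncG μ hμ P hA K

end Lattice

end CBRW

end

/-! ### The proposition in both cases -/

theorem mainTheorem6 {d : ℕ} (μ : PMF ℕ) (hμ : CBRW.IsCritical μ)
    (P : Measure (CBRW.E d)) [IsProbabilityMeasure P] (S : Matrix (Fin d) (Fin d) ℝ)
    (c : CBRW.E d) (r : ℝ) (hr : 0 < r) (a : CBRW.E d) :
    (CBRW.HypH1 μ P S →
      (fun n : ℕ => (CBRW.bpLaw μ P).real
          {T | 1 ≤ CBRW.count T n (CBRW.translate (Metric.closedBall c r) (Real.sqrt n • a))})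
        ~[atTop]
      fun n : ℕ => CBRW.IGauss μ hμ P (Metric.closedBall c r) * CBRW.gaussDensity S a *
        (n : ℝ) ^ (-(d : ℝ) / 2)) ∧
    (CBRW.HypH2 μ P S → (Metric.closedBall c r ∩ CBRW.intLattice d).Nonempty →
      ∀ an : ℕ → CBRW.E d, (∀ n, an n ∈ CBRW.intLattice d) →
      Tendsto (fun n : ℕ => (Real.sqrt n)⁻¹ • an n) atTop (𝓝 a) →
      (fun n : ℕ => (CBRW.bpLaw μ P).real
          {T | 1 ≤ CBRW.count T n (CBRW.translate (Metric.closedBall c r) (an n))})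
        ~[atTop]
      fun n : ℕ => CBRW.ILattice μ hμ P (Metric.closedBall c r) * CBRW.gaussDensity S a *
        (n : ℝ) ^ (-(d : ℝ) / 2)) := by
  have hA : MeasurableSet (Metric.closedBall c r) := Metric.isClosed_closedBall.measurableSet
  constructor
  · rintro ⟨hd, rfl, rfl, h2⟩
    exact (CBRW.localLimit_stdGaussian a).isEquivalent μ hμ Matrix.PosDef.one hd h2 hA
      measure_closedBall_lt_top.ne (Metric.measure_closedBall_pos _ _ hr).ne'
  · rintro ⟨hd, ⟨R, p, hR, hP, hsymm⟩, rfl, hS, hap, h2⟩ hne an han ha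
    obtain ⟨C, hC⟩ := (CBRW.IsLatticeStep.mk hR hP hsymm).localLimit hd hS hap han ha
    have h := hC.isEquivalent μ hμ hS hd h2 hA
      (by
        rw [CBRW.latticeMeasure_apply hA]
        simpa using CBRW.finite_closedBall_inter_intLattice c r)
      (by
        rw [CBRW.latticeMeasure_apply hA]
        simpa [Set.nonempty_iff_ne_empty] using hne)
    rwa [CBRW.setLIntegral_latticeMeasure hA (CBRW.measurable_G μ hμ hA)] at h
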